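/- Setting. Let $\xi(t),\eta(t)$, $t\in\mathbb R$, be complex zero-mean mean-square stationary processes on a probability space with integrable spectral densities $f,g\ge 0$, that is $E\,\xi(t)\overline{\xi(s)}=\frac1{2\pi}\int_{-\infty}^{\infty} e^{i(t-s)\lambda}f(\lambda)\,d\lambda$, and likewise for $\eta$ with $g$. Let them be uncorrelated: $E\,\xi(t)\overline{\eta(s)}=0$ for all $t,s$. Assume the minimality condition: there is a function $\gamma(\lambda)=\int_0^\infty\alpha(t)e^{it\lambda}dt$ with $\alpha\in L_1(0,\infty)$, not identically zero and the restriction to $\mathbb R$ of an entire function of exponential type, such that $\int_{-\infty}^{\infty}\frac{|\gamma(\lambda)|^2}{f(\lambda)+g(\lambda)}d\lambda<\infty$. Let $N_0=K_0=0$, let $N_l,K_l\ge 0$ for $1\le l\le s$, and put $M_l=\sum_{k=0}^l(N_k+K_k)$, $S=\bigcup_{l=1}^s[-M_l-N_l,-M_l]$, $S^+=\bigcup_{l=1}^s[M_l,M_l+N_l]$, $R^s=[0,\infty)\setminus S^+$, $T=S\cup[0,\infty)$, $\mathbb R^-=(-\infty,0)$. For $N\ge 0$ put $N^s=[0,N]\cap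 R^s$. Let $a$ be a complex function with $\int_{N^s}|a(t)|^2dt<\infty$, and let $\mathbf a_N\in L_2(T)$ be equal to $a$ on $N^s$ and to $0$ on $T\setminus N^s$. Put $$A_N\xi=\int_{N^s}a(t)\xi(-t)\,dt,\qquad A_N(e^{i\lambda})=\int_{N^s}a(t)e^{-it\lambda}dt .$$ Define operators in $L_2(T)$ by $$(\mathbf Bx)(t)=\frac1{2\pi}\int_T x(u)\int_{-\infty}^{\infty}\frac{e^{i\lambda(u-t)}}{f(\lambda)+g(\lambda)}d\lambda\,du,\qquad (\mathbf Rx)(t)=\frac1{2\pi}\int_T x(u)\int_{-\infty}^{\infty}e^{-i\lambda(u+t)}\frac{f(\lambda)}{f(\lambda)+g(\lambda)}d\lambda\,du,$$ $$(\mathbf Qx)(t)=\frac1{2\pi}\int_T x(u)\int_{-\infty}^{\infty}e^{-i\lambda(u-t)}\frac{f(\lambda)g(\lambda)}{f(\lambda)+g(\lambda)}d\lambda\,du .$$ These formulas are understood in the sense of sesquilinear forms. With $\hat x_\pm(\lambda)=\int_T x(u)e^{\pm i\lambda u}du$ (the $L_2$ Fourier transforms) the forms are $$\langle \mathbf Bx,z\rangle=\frac1{2\pi}\int\frac{\hat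 x_+\overline{\hat z_+}}{f+g}d\lambda,\qquad \langle \mathbf Rx,z\rangle=\frac1{2\pi}\int\frac{f\,\hat x_-\overline{\hat z_+}}{f+g}d\lambda,\qquad \langle \mathbf Qx,z\rangle=\frac1{2\pi}\int\frac{fg\,\hat x_-\overline{\hat z_-}}{f+g}d\lambda .$$ For a form with weight $\sigma$ and transforms $\hat x,\hat z$, the operator sends $x\in L_2(T)$ with $\int\sigma|\hat x|^2d\lambda<\infty$ to $y\in L_2(T)$ if $y$ lies in the closure of $\{z\in L_2(T):\int\sigma|\hat z|^2d\lambda<\infty\}$ and $\langle y,z\rangle$ equals the form for every $z$ in this set; its domain consists of the $x$ for which such a (then unique) $y$ exists. Here $\langle x,y\rangle=\int_T x(t)\overline{y(t)}dt$. Assume that $\mathbf B$ is invertible, i.e. a bijection of its domain onto $L_2(T)$. An optimal linear estimate $\hat A_N\xi$ of $A_N\xi$ is an element of the closed linear span in $L_2(\Omega)$ of $\{\xi(t)+\eta(t):t\in\mathbb R^-\setminus S\}$ at which the mean-square error is minimal over this span. A spectral characteristic of $\hat A_N\xi$ is a function $h$ in the closed linear span $L_2^s(f+g)$ of $\{e^{it\lambda}:t\in\mathbb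 R^-\setminus S\}$ in $L_2(f+g)$ with $\hat A_N\xi=\int h(e^{i\lambda})(Z_\xi+Z_\eta)(d\lambda)$. Here $h\mapsto\int h\,d(Z_\xi+Z_\eta)$ is the continuous linear map $L_2(f+g)\to L_2(\Omega)$ with $e^{it\lambda}\mapsto\xi(t)+\eta(t)$, $t\in\mathbb R$. Statement. The function $\mathbf a_N$ belongs to the domains of $\mathbf R$ and $\mathbf Q$. The optimal linear estimate $\hat A_N\xi$ exists and is unique. It has a spectral characteristic, unique up to equality almost everywhere, namely $$h_N(e^{i\lambda})=A_N(e^{i\lambda})\frac{f(\lambda)}{f(\lambda)+g(\lambda)}-\frac{C_N(e^{i\lambda})}{f(\lambda)+g(\lambda)},\qquad C_N(e^{i\lambda})=\int_T(\mathbf B^{-1}\mathbf R\mathbf a_N)(t)e^{it\lambda}dt$$ (the last integral in the sense of $L_2$). Its mean-square error is $$\Delta(h_N;f,g)=E|A_N\xi-\hat A_N\xi|^2=\langle\mathbf R\mathbf a_N,\mathbf B^{-1}\mathbf R\mathbf a_N\rangle+\langle\mathbf Q\mathbf a_N,\mathbf a_N\rangle,$$ where $\Delta(h;f,g)=\frac1{2\pi}\int|A_N(e^{i\lambda})-h(e^{i\lambda})|^2f(\lambda)d\lambda+\frac1{2\pi}\int|h(e^{i\lambda})|^2g(\lambda)d\lambda$.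 -/

import Mathlib

open MeasureTheory Complex

noncomputable section

namespace MissingFilter

/-! ### Geometry of the observation set -/

/-- `M_l = ∑_{k=0}^{l} (N_k + K_k)`. -/
def gapStart (Nl Kl : ℕ → ℝ) (l : ℕ) : ℝ := ∑ k ∈ Finset.range (l + 1), (Nl k + Kl k)

/-- `S = ⋃_{l=1}^{s} [-M_l - N_l, -M_l]`: the moments of the missing observations. -/
def gaps (s : ℕ) (Nl Kl : ℕ → ℝ) : Set ℝ :=
  ⋃ l ∈ Finset.Icc 1 s, Set.Icc (-gapStart Nl Kl l - Nl l) (-gapStart Nl Kl l)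

/-- `S⁺ = ⋃_{l=1}^{s} [M_l, M_l + N_l]`. -/
def gapsPos (s : ℕ) (Nl Kl : ℕ → ℝ) : Set ℝ :=
  ⋃ l ∈ Finset.Icc 1 s, Set.Icc (gapStart Nl Kl l) (gapStart Nl Kl l + Nl l)

/-- `ℝ⁻ \ S`: the moments of observation. -/
def obsSet (s : ℕ) (Nl Kl : ℕ → ℝ) : Set ℝ := Set.Iio 0 \ gaps s Nl Kl

/-- `T = S ∪ [0, ∞)`. -/
def unobsSet (s : ℕ) (Nl Kl : ℕ → ℝ) : Set ℝ := gaps s Nl Kl ∪ Set.Ici 0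

/-- `R^s = [0, ∞) \ S⁺`. -/
def weightSet (s : ℕ) (Nl Kl : ℕ → ℝ) : Set ℝ := Set.Ici 0 \ gapsPos s Nl Kl

/-- `N^s = [0, N] ∩ R^s`. -/
def truncSet (s : ℕ) (Nl Kl : ℕ → ℝ) (N : ℝ) : Set ℝ := Set.Icc 0 N ∩ weightSet s Nl Kl

theorem measurableSet_gapsPos (s : ℕ) (Nl Kl : ℕ → ℝ) : MeasurableSet (gapsPos s Nl Kl) :=
  Finset.measurableSet_biUnion _ fun _ _ => measurableSet_Icc

theorem measurableSet_truncSet (s : ℕ) (Nl Kl : ℕ → ℝ) (N : ℝ) :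
    MeasurableSet (truncSet s Nl Kl N) :=
  measurableSet_Icc.inter (measurableSet_Ici.diff (measurableSet_gapsPos s Nl Kl))

theorem truncSet_subset_unobsSet (s : ℕ) (Nl Kl : ℕ → ℝ) (N : ℝ) :
    truncSet s Nl Kl N ⊆ unobsSet s Nl Kl := fun _ ht => Or.inr ht.1.1

/-! ### Spectral densities and stationary processes -/

/-- A spectral density of a (finite variance) stationary process. -/
structure IsSpectralDensity (f : ℝ → ℝ) : Prop where
  nonneg : ∀ lam, 0 ≤ f lam
  integrable : Integrable f

/-- `γ(λ) = ∫_0^∞ α(t) e^{itλ} dt`. -/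
def gammaOf (α : ℝ → ℂ) (lam : ℝ) : ℂ := ∫ t in Set.Ioi (0 : ℝ), α t * exp (I * t * lam)

/-- `γ : ℝ → ℂ` is the restriction to the real line of an entire function of exponential type. -/
def IsExponentialType (γ : ℝ → ℂ) : Prop :=
  ∃ F : ℂ → ℂ, Differentiable ℂ F ∧ (∃ C τ : ℝ, ∀ z, ‖F z‖ ≤ C * Real.exp (τ * ‖z‖)) ∧
    ∀ lam : ℝ, F lam = γ lam

/-- The minimality condition `∫ |γ|² / (f + g) dλ < ∞` for some nontrivial function `γ` of
exponential type of the form `γ(λ) = ∫_0^∞ α(t) e^{itλ} dt`. The quotient is taken in `[0, ∞]`,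
so that it is infinite where `f + g = 0` and `γ ≠ 0`. -/
def MinimalityCondition (f g : ℝ → ℝ) : Prop :=
  ∃ α : ℝ → ℂ, IntegrableOn α (Set.Ioi 0) ∧ IsExponentialType (gammaOf α) ∧
    (∃ lam, gammaOf α lam ≠ 0) ∧
    ∫⁻ lam, ‖gammaOf α lam‖ₑ ^ 2 / ENNReal.ofReal (f lam + g lam) < ⊤

section Stationary

variable {Ω : Type*} [MeasurableSpace Ω] {P : Measure Ω}

/-- A zero mean stationary process `ξ : ℝ → L²(Ω)` with spectral density `f`:
`E ξ(t) conj ξ(s) = (1/2π) ∫ e^{i(t-s)λ} f(λ) dλ`. -/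
structure IsStationary (ξ : ℝ → Lp ℂ 2 P) (f : ℝ → ℝ) : Prop where
  density : IsSpectralDensity f
  mean_zero : ∀ t, ∫ ω, ξ t ω ∂P = 0
  covariance : ∀ t s, ∫ ω, ξ t ω * (starRingEnd ℂ) (ξ s ω) ∂P =
    (1 / (2 * Real.pi) : ℂ) * ∫ lam : ℝ, exp (I * (t - s) * lam) * f lam

/-- The processes are uncorrelated: `E ξ(t) conj η(s) = 0`. -/
def Uncorrelated (ξ η : ℝ → Lp ℂ 2 P) : Prop :=
  ∀ t s, ∫ ω, ξ t ω * (starRingEnd ℂ) (η s ω) ∂P = 0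

/-- The closed linear span `H(ζ; U)` in `L²(Ω)` of the variables `ζ(t)`, `t ∈ U`. -/
def closedSpan (ζ : ℝ → Lp ℂ 2 P) (U : Set ℝ) : Submodule ℂ (Lp ℂ 2 P) :=
  (Submodule.span ℂ (ζ '' U)).topologicalClosure

/-- The mean-square error `E |X - Y|²`. -/
def mse (X Y : Lp ℂ 2 P) : ℝ := ∫ ω, ‖X ω - Y ω‖ ^ 2 ∂P

/-- `Y` is a mean-square optimal linear estimate of `X` from the observations `ζ(t)`, `t ∈ U`. -/
def IsOptimalEstimate (ζ : ℝ → Lp ℂ 2 P) (U : Set ℝ) (X Y : Lp ℂ 2 P) : Prop :=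
  Y ∈ closedSpan ζ U ∧ ∀ Y' ∈ closedSpan ζ U, mse X Y ≤ mse X Y'

/-- The functional `∫_D a(t) ξ(-t) dt`, a mean-square (Bochner) integral in `L²(Ω)`. -/
def functional (a : ℝ → ℂ) (D : Set ℝ) (ξ : ℝ → Lp ℂ 2 P) : Lp ℂ 2 P :=
  ∫ t in D, a t • ξ (-t)

end Stationary

/-! ### The spaces `L₂(w)` and spectral integrals -/

/-- The measure with density `w` on the real line. -/
def weighted (w : ℝ → ℝ) : Measure ℝ := volume.withDensity fun lam => ENNReal.ofReal (w lam)

/-- `φ ∈ L₂(w)` is (the class of) the function `λ ↦ e^{itλ}`. -/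
def IsHarmonic (w : ℝ → ℝ) (t : ℝ) (φ : Lp ℂ 2 (weighted w)) : Prop :=
  φ =ᵐ[weighted w] fun lam : ℝ => exp (I * t * lam)

/-- The closed subspace of `L₂(w)` generated by the functions `e^{itλ}`, `t ∈ U`. -/
def harmonicSpan (w : ℝ → ℝ) (U : Set ℝ) : Submodule ℂ (Lp ℂ 2 (weighted w)) :=
  (Submodule.span ℂ {φ | ∃ t ∈ U, IsHarmonic w t φ}).topologicalClosure

/-- Let `ζ` be a stationary process with spectral density `w` and spectral stochastic measure
`Z_ζ`. The map `h ↦ ∫ h(λ) Z_ζ(dλ)` is, up to the factor `2π`, the isometry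
from `L₂(w)` to `L²(Ω)` that extends `e^{itλ} ↦ ζ(t)` by linearity and continuity. This is its
graph: the closed linear span of the pairs `(e^{itλ}, ζ(t))`, `t ∈ ℝ`. -/
def spectralIntegralGraph {Ω : Type*} [MeasurableSpace Ω] {P : Measure Ω}
    (ζ : ℝ → Lp ℂ 2 P) (w : ℝ → ℝ) : Submodule ℂ (Lp ℂ 2 (weighted w) × Lp ℂ 2 P) :=
  (Submodule.span ℂ {p | ∃ t : ℝ, IsHarmonic w t p.1 ∧ p.2 = ζ t}).topologicalClosure

/-- `h` is a spectral characteristic of the estimate `Y` based on the observations `ζ(t)`,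
`t ∈ U`, where `ζ` has spectral density `w`: `h ∈ L₂(w)` belongs to the closed span of
`e^{itλ}`, `t ∈ U`, and `Y = ∫ h(λ) Z_ζ(dλ)`. -/
def IsSpectralCharacteristic {Ω : Type*} [MeasurableSpace Ω] {P : Measure Ω}
    (ζ : ℝ → Lp ℂ 2 P) (w : ℝ → ℝ) (U : Set ℝ) (h : ℝ → ℂ) (Y : Lp ℂ 2 P) : Prop :=
  ∃ hh : MemLp h 2 (weighted w),
    hh.toLp h ∈ harmonicSpan w U ∧ (hh.toLp h, Y) ∈ spectralIntegralGraph ζ w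

/-- `Δ(h; f, g) = (1/2π) ∫ |A - h|² f dλ + (1/2π) ∫ |h|² g dλ`. -/
def spectralError (A h : ℝ → ℂ) (f g : ℝ → ℝ) : ℝ :=
  1 / (2 * Real.pi) * (∫ lam, ‖A lam - h lam‖ ^ 2 * f lam) +
    1 / (2 * Real.pi) * ∫ lam, ‖h lam‖ ^ 2 * g lam

/-! ### `L₂(T)`, Fourier transforms and operators given by spectral kernels -/

/-- `L₂(T)`, realised as the subspace of `L₂(ℝ)` of the functions vanishing a.e. outside `T`. -/
def L2On (T : Set ℝ) : Submodule ℂ (Lp ℂ 2 (volume : Measure ℝ)) where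
  carrier := {x | ∀ᵐ t, t ∉ T → x t = 0}
  zero_mem' := by
    filter_upwards [Lp.coeFn_zero ℂ 2 (volume : Measure ℝ)] with t ht _
    exact ht
  add_mem' := by
    intro x y hx hy
    filter_upwards [hx, hy, Lp.coeFn_add x y] with t h1 h2 h3 hT
    exact h3.trans (by simp [h1 hT, h2 hT])
  smul_mem' := by
    intro c x hx
    filter_upwards [hx, Lp.coeFn_smul c x] with t h1 h3 hT
    exact h3.trans (by simp [h1 hT])

/-- A Fourier transform on `L₂(ℝ)`, in one of the two directions. -/
abbrev L2Transform := Lp ℂ 2 (volume : Measure ℝ) ≃ₗᵢ[ℂ] Lp ℂ 2 (volume : Measure ℝ)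

/-- With the kernel `e^{2πiuv}`. -/
def plusTransform : L2Transform := (Lp.fourierTransformₗᵢ ℝ ℂ).symm

/-- With the kernel `e^{-2πiuv}`. -/
def minusTransform : L2Transform := Lp.fourierTransformₗᵢ ℝ ℂ

/-- In the angular variable: `hat plusTransform x` is `λ ↦ ∫ x(u) e^{iuλ} du`
and `hat minusTransform x` is `λ ↦ ∫ x(u) e^{-iuλ} du` (integrals in the sense of `L₂`). -/
def hat (U : L2Transform) (x : Lp ℂ 2 (volume : Measure ℝ)) (lam : ℝ) : ℂ :=
  U x (lam / (2 * Real.pi))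

theorem quasi_scale : Measure.QuasiMeasurePreserving (fun lam : ℝ => lam / (2 * Real.pi))
    volume volume := by
  have h0 : (2 * Real.pi)⁻¹ ≠ 0 := by positivity
  refine ⟨by fun_prop, ?_⟩
  simp only [div_eq_mul_inv]
  rw [Real.map_volume_mul_right h0]
  exact Measure.smul_absolutelyContinuous

theorem hat_add (U : L2Transform) (x y : Lp ℂ 2 (volume : Measure ℝ)) :
    hat U (x + y) =ᵐ[volume] fun lam => hat U x lam + hat U y lam := by
  have h := quasi_scale.ae_eq_comp (Lp.coeFn_add (U x) (U y))
  filter_upwards [h] with lam hl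
  simpa [hat] using hl

theorem hat_smul (U : L2Transform) (c : ℂ) (x : Lp ℂ 2 (volume : Measure ℝ)) :
    hat U (c • x) =ᵐ[volume] fun lam => c * hat U x lam := by
  have h := quasi_scale.ae_eq_comp (Lp.coeFn_smul c (U x))
  filter_upwards [h] with lam hl
  simpa [hat] using hl

/-- `λ ↦ √σ(λ) x̂(λ)`. -/
def weightedHat (σ : ℝ → ℝ) (U : L2Transform) (x : Lp ℂ 2 (volume : Measure ℝ)) (lam : ℝ) : ℂ :=
  (Real.sqrt (σ lam) : ℂ) * hat U x lam

theorem weightedHat_add (σ : ℝ → ℝ) (U : L2Transform) (x y : Lp ℂ 2 (volume : Measure ℝ)) :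
    weightedHat σ U (x + y) =ᵐ[volume] weightedHat σ U x + weightedHat σ U y := by
  filter_upwards [hat_add U x y] with lam h
  simp [weightedHat, h, mul_add]

theorem weightedHat_smul (σ : ℝ → ℝ) (U : L2Transform) (c : ℂ)
    (x : Lp ℂ 2 (volume : Measure ℝ)) :
    weightedHat σ U (c • x) =ᵐ[volume] c • weightedHat σ U x := by
  filter_upwards [hat_smul U c x] with lam h
  simp [weightedHat, h]; ring

/-- The functions `x ∈ L₂(T)` with `∫ σ |x̂|² dλ < ∞`. -/
def formDomain (T : Set ℝ) (σ : ℝ → ℝ) (U : L2Transform) : Submodule ℂ (L2On T) where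
  carrier := {x | MemLp (weightedHat σ U x) 2 volume}
  zero_mem' := by
    have h := weightedHat_smul σ U 0 0
    simp only [zero_smul] at h
    exact (memLp_congr_ae h).2 MemLp.zero
  add_mem' := by
    intro x y hx hy
    exact (memLp_congr_ae (weightedHat_add σ U x y)).2 (MemLp.add hx hy)
  smul_mem' := by
    intro c x hx
    exact (memLp_congr_ae (weightedHat_smul σ U c x)).2 (MemLp.const_smul hx c)

/-- The sesquilinear form `(1/2π) ∫ σ(λ) x̂(λ) conj (ẑ(λ)) dλ` for `σ ≥ 0`, with `x̂` formed by `U`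
and `ẑ` by `V`. -/
def kernelForm (σ : ℝ → ℝ) (U V : L2Transform) (x z : Lp ℂ 2 (volume : Measure ℝ)) : ℂ :=
  (1 / (2 * Real.pi) : ℂ) *
    ∫ lam, weightedHat σ U x lam * (starRingEnd ℂ) (weightedHat σ V z lam)

theorem integrable_form {σ : ℝ → ℝ} {U V : L2Transform} {x z : Lp ℂ 2 (volume : Measure ℝ)}
    (hx : MemLp (weightedHat σ U x) 2 volume) (hz : MemLp (weightedHat σ V z) 2 volume) :
    Integrable fun lam => weightedHat σ U x lam * (starRingEnd ℂ) (weightedHat σ V z lam) :=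
  MemLp.integrable_mul (p := 2) (q := 2) hx hz.star

theorem kernelForm_add {σ : ℝ → ℝ} {U V : L2Transform} {x y z : Lp ℂ 2 (volume : Measure ℝ)}
    (hx : MemLp (weightedHat σ U x) 2 volume) (hy : MemLp (weightedHat σ U y) 2 volume)
    (hz : MemLp (weightedHat σ V z) 2 volume) :
    kernelForm σ U V (x + y) z = kernelForm σ U V x z + kernelForm σ U V y z := by
  unfold kernelForm
  rw [← mul_add, ← integral_add (integrable_form hx hz) (integrable_form hy hz)]
  congr 1
  refine integral_congr_ae ?_
  filter_upwards [weightedHat_add σ U x y] with lam h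
  simp [h, add_mul]

theorem kernelForm_smul {σ : ℝ → ℝ} {U V : L2Transform} (c : ℂ)
    (x z : Lp ℂ 2 (volume : Measure ℝ)) :
    kernelForm σ U V (c • x) z = c * kernelForm σ U V x z := by
  unfold kernelForm
  rw [mul_left_comm]
  congr 1
  rw [← integral_const_mul (μ := volume) c]
  refine integral_congr_ae ?_
  filter_upwards [weightedHat_smul σ U c x] with lam h
  simp [h, mul_assoc]

/-- The graph of the operator of a kernel form: `(x, y)` belongs to it if `∫ σ |x̂|² < ∞`, `y` lies
in the closure of the form domain, and `⟨y, z⟩ = (1/2π) ∫ σ x̂ conj ẑ` for all `z` in the form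
domain. -/
def kernelGraph (T : Set ℝ) (σ : ℝ → ℝ) (U V : L2Transform) :
    Submodule ℂ (L2On T × L2On T) where
  carrier := {p | p.1 ∈ formDomain T σ U ∧ p.2 ∈ (formDomain T σ V).topologicalClosure ∧
    ∀ z ∈ formDomain T σ V, inner ℂ z p.2 = kernelForm σ U V p.1 z}
  zero_mem' := by
    refine ⟨Submodule.zero_mem _, Submodule.zero_mem _, fun z _ => ?_⟩
    have h := kernelForm_smul (σ := σ) (U := U) (V := V) 0 0 (z : Lp ℂ 2 (volume : Measure ℝ))
    simp only [zero_smul, zero_mul] at h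
    simp [h]
  add_mem' := by
    rintro p q ⟨h1, h2, h3⟩ ⟨k1, k2, k3⟩
    refine ⟨Submodule.add_mem _ h1 k1, Submodule.add_mem _ h2 k2, fun z hz => ?_⟩
    have h := kernelForm_add h1 k1 hz
    simp only [Prod.fst_add, Prod.snd_add, Submodule.coe_add, inner_add_right, h3 z hz, k3 z hz, h]
  smul_mem' := by
    rintro c p ⟨h1, h2, h3⟩
    refine ⟨Submodule.smul_mem _ c h1, Submodule.smul_mem _ c h2, fun z hz => ?_⟩
    simp only [Prod.smul_fst, Prod.smul_snd, Submodule.coe_smul, inner_smul_right, h3 z hz,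
      kernelForm_smul]

/-- The operator `(K x)(t) = (1/2π) ∫_T x(u) ∫ e^{i(±u ∓' t)λ} σ(λ) dλ du`, `t ∈ T`, in `L₂(T)`,
where `U = plusTransform` gives `+u` and `V = plusTransform` gives `-t`, while
`U = minusTransform` gives `-u` and `V = minusTransform` gives `+t`. As the inner integral need not
converge, `K` is the operator of the form `⟨K x, z⟩ = (1/2π) ∫ σ x̂ conj ẑ`, which may be
unbounded and only partially defined. -/
def kernelOp (T : Set ℝ) (σ : ℝ → ℝ) (U V : L2Transform) : L2On T →ₗ.[ℂ] L2On T :=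
  (kernelGraph T σ U V).toLinearPMap

/-- The graph of `kernelOp` is `kernelGraph`. -/
theorem kernelOp_graph (T : Set ℝ) (σ : ℝ → ℝ) (U V : L2Transform) :
    (kernelOp T σ U V).graph = kernelGraph T σ U V := by
  refine Submodule.toLinearPMap_graph_eq _ ?_
  rintro ⟨x, y⟩ ⟨_, h2, h3⟩ hx
  simp only at hx h2 h3
  subst hx
  have h0 : ∀ z ∈ formDomain T σ V, inner ℂ z y = 0 := by
    intro z hz
    have h := kernelForm_smul (σ := σ) (U := U) (V := V) 0 0 (z : Lp ℂ 2 (volume : Measure ℝ))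
    simp only [zero_smul, zero_mul] at h
    rw [h3 z hz]
    simpa using h
  have h4 : y ∈ (formDomain T σ V).topologicalClosureᗮ := by
    rw [Submodule.orthogonal_closure]
    exact (Submodule.mem_orthogonal _ _).2 h0
  exact inner_self_eq_zero.1 ((Submodule.mem_orthogonal _ _).1 h4 y h2)

/-- `B`: the kernel `(1/2π) ∫ e^{i(u-t)λ} / (f + g) dλ`. -/
def opB (T : Set ℝ) (f g : ℝ → ℝ) : L2On T →ₗ.[ℂ] L2On T :=
  kernelOp T (fun lam => 1 / (f lam + g lam)) plusTransform plusTransform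

/-- `R`: the kernel `(1/2π) ∫ e^{-i(u+t)λ} f / (f + g) dλ`. -/
def opR (T : Set ℝ) (f g : ℝ → ℝ) : L2On T →ₗ.[ℂ] L2On T :=
  kernelOp T (fun lam => f lam / (f lam + g lam)) minusTransform plusTransform

/-- `Q`: the kernel `(1/2π) ∫ e^{-i(u-t)λ} f g / (f + g) dλ`. -/
def opQ (T : Set ℝ) (f g : ℝ → ℝ) : L2On T →ₗ.[ℂ] L2On T :=
  kernelOp T (fun lam => f lam * g lam / (f lam + g lam)) minusTransform minusTransform

/-- `B` is invertible: a bijection of its domain onto `L₂(T)`. -/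
def IsInvertible {T : Set ℝ} (B : L2On T →ₗ.[ℂ] L2On T) : Prop :=
  Function.Bijective fun x : B.domain => B x

/-- `B⁻¹ y`. -/
def invApply {T : Set ℝ} (B : L2On T →ₗ.[ℂ] L2On T) (hB : IsInvertible B) (y : L2On T) : L2On T :=
  ((Equiv.ofBijective _ hB).symm y : B.domain)

/-- The inner product `⟨x, y⟩ = ∫_T x(t) conj (y(t)) dt` of `L₂(T)`. -/
def pairing {T : Set ℝ} (x y : L2On T) : ℂ :=
  ∫ t in T, (x : Lp ℂ 2 (volume : Measure ℝ)) t *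
    (starRingEnd ℂ) ((y : Lp ℂ 2 (volume : Measure ℝ)) t)

/-- The function equal to `a` on `D ⊆ T` and to zero on the rest of `T`, as an element
of `L₂(T)`. -/
def restrictTo {T D : Set ℝ} {a : ℝ → ℂ} (hD : MeasurableSet D) (hDT : D ⊆ T)
    (ha : MemLp a 2 (volume.restrict D)) : L2On T :=
  ⟨((memLp_indicator_iff_restrict hD).2 ha).toLp (D.indicator a), by
    filter_upwards [((memLp_indicator_iff_restrict hD).2 ha).coeFn_toLp] with t ht hT
    rw [ht, Set.indicator_of_notMem fun h => hT (hDT h)]⟩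

/-- `A(e^{iλ}) = ∫_D a(t) e^{-itλ} dt`. -/
def transferFn (a : ℝ → ℂ) (D : Set ℝ) (lam : ℝ) : ℂ := ∫ t in D, a t * exp (-(I * t * lam))

/-- `h = A f / (f + g) - C / (f + g)`, where `C(e^{iλ}) = ∫_T c(t) e^{itλ} dt`. -/
def optimalCharacteristic {T : Set ℝ} (A : ℝ → ℂ) (f g : ℝ → ℝ) (c : L2On T) (lam : ℝ) : ℂ :=
  A lam * (f lam / (f lam + g lam) : ℝ) - hat plusTransform c lam / (f lam + g lam : ℝ)

end MissingFilter

end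

open MissingFilter

noncomputable section

namespace MissingFilter

section Fourier

open FourierTransform SchwartzMap

/-! ### Fourier transforms of integrable functions in `L₂` -/

/-! Write `w = f + g`, `ζ = ξ + η`, `U` for the observed moments, `A` for the transfer function, and
`ĉ` for the transform of `c = B⁻¹ R a_N`, so that `h = (A f - ĉ) / w`. The estimate is a Hilbert
space projection. It is enough that `h` lies in the closed span of the observed harmonics and that
the error is orthogonal to `ζ(t)` for every `t ∈ U`; the rest is Pythagoras
(`mse_eq_add_of_orthogonal`).

Orthogonality. Since `A f - w h = ĉ`, the covariance of the error with `ζ(t)` is `(1/2π) ∫ ĉ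
e^{-itλ} dλ`, the value at `t` of the continuous representative of `c`. It vanishes on `U`, because
`c` lives on `T` and `U` is the open complement of `T` (`integral_hat_mul_exp_eq_zero`,
`inner_sub_eq_zero`).

Membership in the span. If `ψ ∈ L₂(w)` is orthogonal to the observed harmonics, then `w ψ` has an
inverse transform supported on `T`, so `ψ = x̂ / w` with `x` in the form domain of `B`. Hence `h` is
in the span once `∫ h conj x̂ = 0` for all such `x`, and this is `B c = R a_N` read in the sense of
forms (`mem_harmonicSpan_of_forall`, `optimalCharacteristic_mem_harmonicSpan`).

The second argument needs `w ψ ∈ L₂`, and the domain of `Q` needs a bounded weight. Both follow from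
boundedness of `w`, which is not assumed but forced by the invertibility of `B`
(`MinimalityCondition.exists_ae_le`). By Hellinger–Toeplitz `B⁻¹` is bounded, hence `∫ |x̂|² ≤ C ∫
|x̂|² / w` on the form domain. Multiplying `γ` by any trigonometric polynomial gives, up to a
unimodular factor, such an `x̂`. Density of trigonometric polynomials turns the integral inequality
into `|γ|² ≤ C |γ|² / w` almost everywhere, that is `w ≤ C`, since `γ` has almost no zeros.

The error. Orthogonality gives `‖X - Y‖² = ‖X‖² - ‖Y‖²`. A pointwise identity, together with `∫ ĉ
conj h = 0`, reduces this to `(1/2π) ∫ (f g |A|² + |ĉ|²) / w`. The same integral is `Δ(h; f, g)`,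
and its two terms are `⟨Q a_N, a_N⟩` and `⟨B c, c⟩ = ⟨R a_N, c⟩`. -/

theorem ae_eq_of_schwartz {x y : ℝ → ℂ} (hx : LocallyIntegrable x) (hy : LocallyIntegrable y)
    (h : ∀ φ : 𝓢(ℝ, ℂ), ∫ t, φ t * x t = ∫ t, φ t * y t) : x =ᵐ[volume] y := by
  refine ae_eq_of_integral_contDiff_smul_eq hx hy fun k hk hc => ?_
  have h1 : HasCompactSupport fun t => (k t : ℂ) :=
    hc.comp_left (g := fun r : ℝ => (r : ℂ)) (by simp)
  have h2 : ContDiff ℝ (⊤ : ℕ∞) fun t => (k t : ℂ) := Complex.ofRealCLM.contDiff.comp hk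
  simpa using h (h1.toSchwartzMap h2)

theorem locallyIntegrable_Lp (x : Lp ℂ 2 (volume : Measure ℝ)) : LocallyIntegrable x :=
  (Lp.memLp x).locallyIntegrable (by norm_num)

/-- The `L₂` transform agrees with the transform of tempered distributions, so it can be moved onto
the test function. With the analogous identity for integrable functions this compares the `L₂` and
`L₁` transforms without approximation. -/
theorem integral_mul_plusTransform (x : Lp ℂ 2 (volume : Measure ℝ)) (φ : 𝓢(ℝ, ℂ)) :
    ∫ t, φ t * plusTransform x t = ∫ t, (𝓕⁻ φ) t * x t := by
  have h := congrArg (fun T => T φ) (Lp.fourierInv_toTemperedDistribution_eq x)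
  simp only [TemperedDistribution.fourierInv_apply, Lp.toTemperedDistribution_apply,
    smul_eq_mul] at h
  exact h.symm

theorem integral_mul_minusTransform (x : Lp ℂ 2 (volume : Measure ℝ)) (φ : 𝓢(ℝ, ℂ)) :
    ∫ t, φ t * minusTransform x t = ∫ t, (𝓕 φ) t * x t := by
  have h := congrArg (fun T => T φ) (Lp.fourier_toTemperedDistribution_eq x)
  simp only [TemperedDistribution.fourier_apply, Lp.toTemperedDistribution_apply,
    smul_eq_mul] at h
  exact h.symm

theorem integral_mul_fourier {β : ℝ → ℂ} (hβ : Integrable β) (φ : 𝓢(ℝ, ℂ)) :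
    ∫ t, φ t * (𝓕 β) t = ∫ t, (𝓕 φ) t * β t := by
  have h := VectorFourier.integral_fourierIntegral_smul_eq_flip (μ := volume) (ν := volume)
    (L := innerₗ ℝ) Real.continuous_fourierChar (by fun_prop) hβ (φ.integrable (μ := volume))
  simp only [flip_innerₗ, smul_eq_mul] at h
  simp_rw [mul_comm _ (𝓕 β _), mul_comm _ (β _)]
  exact h

theorem integral_mul_fourierInv {β : ℝ → ℂ} (hβ : Integrable β) (φ : 𝓢(ℝ, ℂ)) :
    ∫ t, φ t * (𝓕⁻ β) t = ∫ t, (𝓕⁻ φ) t * β t := by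
  have h := VectorFourier.integral_fourierIntegral_smul_eq_flip (μ := volume) (ν := volume)
    (L := -innerₗ ℝ) Real.continuous_fourierChar (by
      simp only [LinearMap.neg_apply]; fun_prop) hβ (φ.integrable (μ := volume))
  have hf : (-innerₗ ℝ).flip = -innerₗ ℝ := by
    ext; simp
  rw [hf] at h
  simp only [smul_eq_mul] at h
  simp_rw [mul_comm _ (𝓕⁻ β _), mul_comm _ (β _), SchwartzMap.fourierInv_coe]
  exact h

theorem locallyIntegrable_fourier {β : ℝ → ℂ} (hβ : Integrable β) : LocallyIntegrable (𝓕 β) :=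
  (VectorFourier.fourierIntegral_continuous Real.continuous_fourierChar
    (by fun_prop : Continuous fun p : ℝ × ℝ => (innerₗ ℝ) p.1 p.2) hβ).locallyIntegrable

theorem minusTransform_ae_eq {x : Lp ℂ 2 (volume : Measure ℝ)} {β : ℝ → ℂ} (hβ : Integrable β)
    (h : x =ᵐ[volume] β) : minusTransform x =ᵐ[volume] 𝓕 β := by
  refine ae_eq_of_schwartz (locallyIntegrable_Lp _) (locallyIntegrable_fourier hβ) fun φ => ?_
  rw [integral_mul_minusTransform, integral_mul_fourier hβ]
  exact integral_congr_ae (h.mono fun t ht => by simp only [ht])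

theorem ae_eq_of_plusTransform {x : Lp ℂ 2 (volume : Measure ℝ)} {β : ℝ → ℂ} (hβ : Integrable β)
    (h : plusTransform x =ᵐ[volume] 𝓕⁻ β) : x =ᵐ[volume] β := by
  refine ae_eq_of_schwartz (locallyIntegrable_Lp _) hβ.locallyIntegrable fun φ => ?_
  -- Testing against `𝓕 φ` loses nothing, as `𝓕⁻ (𝓕 φ) = φ` is an arbitrary Schwartz function.
  have h1 := integral_mul_plusTransform x (𝓕 φ)
  have h2 := integral_mul_fourierInv hβ (𝓕 φ)
  rw [fourierInv_fourier_eq] at h1 h2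
  rw [← h1, ← h2]
  exact integral_congr_ae (h.mono fun t ht => by simp only [ht])

/-- An integrable function whose Fourier transform vanishes is zero. -/
theorem ae_eq_zero_of_fourier {β : ℝ → ℂ} (hβ : Integrable β) (h : ∀ v, 𝓕 β v = 0) :
    β =ᵐ[volume] 0 := by
  refine ae_eq_of_schwartz hβ.locallyIntegrable
    (locallyIntegrable_zero) fun φ => ?_
  have h2 := integral_mul_fourier hβ (𝓕⁻ φ)
  rw [fourier_fourierInv_eq] at h2
  rw [← h2]
  simp [h]

/-! ### The transforms in the angular variable -/

theorem fourier_div_two_pi (β : ℝ → ℂ) (lam : ℝ) :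
    𝓕 β (lam / (2 * Real.pi)) = ∫ u : ℝ, β u * exp (-(I * u * lam)) := by
  rw [Real.fourier_eq']
  refine integral_congr_ae (Filter.Eventually.of_forall fun u => ?_)
  have : (Real.pi : ℂ) ≠ 0 := by exact_mod_cast Real.pi_ne_zero
  simp only [RCLike.inner_apply, conj_trivial, smul_eq_mul]
  rw [mul_comm]
  congr 2
  push_cast
  field_simp

theorem fourierInv_div_two_pi (β : ℝ → ℂ) (lam : ℝ) :
    𝓕⁻ β (lam / (2 * Real.pi)) = ∫ u : ℝ, β u * exp (I * u * lam) := by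
  rw [Real.fourierInv_eq']
  refine integral_congr_ae (Filter.Eventually.of_forall fun u => ?_)
  have : (Real.pi : ℂ) ≠ 0 := by exact_mod_cast Real.pi_ne_zero
  simp only [RCLike.inner_apply, conj_trivial, smul_eq_mul]
  rw [mul_comm]
  congr 2
  push_cast
  field_simp

theorem quasi_scale_inv : Measure.QuasiMeasurePreserving (fun v : ℝ => v * (2 * Real.pi))
    volume volume := by
  have h0 : (2 * Real.pi) ≠ 0 := by positivity
  refine ⟨by fun_prop, ?_⟩
  rw [Real.map_volume_mul_right h0]
  exact Measure.smul_absolutelyContinuous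

theorem hat_minus_ae_eq {x : Lp ℂ 2 (volume : Measure ℝ)} {β : ℝ → ℂ} (hβ : Integrable β)
    (h : x =ᵐ[volume] β) :
    hat minusTransform x =ᵐ[volume] fun lam => ∫ u : ℝ, β u * exp (-(I * u * lam)) := by
  filter_upwards [quasi_scale.ae_eq_comp (minusTransform_ae_eq hβ h)] with lam hl
  rw [← fourier_div_two_pi]
  exact hl

theorem hat_mul_two_pi (U : L2Transform) (x : Lp ℂ 2 (volume : Measure ℝ)) (v : ℝ) :
    hat U x (v * (2 * Real.pi)) = U x v := by
  have h0 : (2 * Real.pi) ≠ 0 := by positivity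
  simp [hat, h0]

theorem ae_eq_of_hat_plus {x : Lp ℂ 2 (volume : Measure ℝ)} {β : ℝ → ℂ} (hβ : Integrable β)
    (h : hat plusTransform x =ᵐ[volume] fun lam => ∫ u : ℝ, β u * exp (I * u * lam)) :
    x =ᵐ[volume] β := by
  refine ae_eq_of_plusTransform hβ ?_
  have h0 : (2 * Real.pi) ≠ 0 := by positivity
  filter_upwards [quasi_scale_inv.ae_eq_comp h] with v hv
  simp only [Function.comp_apply, hat_mul_two_pi, ← fourierInv_div_two_pi] at hv
  rw [hv, mul_div_cancel_right₀ _ h0]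

theorem integral_scale (F : ℝ → ℂ) :
    ∫ v, F (v * (2 * Real.pi)) = (1 / (2 * Real.pi) : ℂ) * ∫ lam, F lam := by
  have h0 : 0 < (2 * Real.pi) := by positivity
  rw [Measure.integral_comp_mul_right, abs_of_pos (inv_pos.2 h0), Complex.real_smul]
  push_cast
  simp

/-- Inversion formula for `hat plusTransform`. -/
theorem ae_eq_inversion {x : Lp ℂ 2 (volume : Measure ℝ)}
    (hx : Integrable (hat plusTransform x)) :
    x =ᵐ[volume] fun t : ℝ => (1 / (2 * Real.pi) : ℂ) *
      ∫ lam : ℝ, hat plusTransform x lam * exp (-(I * t * lam)) := by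
  have h0 : (2 * Real.pi) ≠ 0 := by positivity
  have h1 : Integrable (plusTransform x : ℝ → ℂ) := by
    have := hx.comp_mul_right' h0
    simpa only [hat_mul_two_pi] using this
  have h2 := minusTransform_ae_eq h1 (Filter.EventuallyEq.refl _ _)
  have h3 : minusTransform (plusTransform x) = x :=
    (Lp.fourierTransformₗᵢ ℝ ℂ).apply_symm_apply x
  rw [h3] at h2
  filter_upwards [h2] with t ht
  rw [ht, ← integral_scale, Real.fourier_eq']
  refine integral_congr_ae (Filter.Eventually.of_forall fun v => ?_)
  simp only [RCLike.inner_apply, conj_trivial, smul_eq_mul, hat_mul_two_pi]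
  rw [mul_comm]
  congr 2
  push_cast
  ring

theorem memLp_hat (U : L2Transform) (x : Lp ℂ 2 (volume : Measure ℝ)) :
    MemLp (hat U x) 2 volume := by
  have h0 : (2 * Real.pi)⁻¹ ≠ 0 := by positivity
  have h := Lp.memLp (U x)
  refine MemLp.comp_of_map (g := (U x : ℝ → ℂ)) (f := fun lam : ℝ => lam / (2 * Real.pi)) ?_
    (by fun_prop)
  simp only [div_eq_mul_inv]
  rw [Real.map_volume_mul_right h0]
  exact h.smul_measure (by finiteness)

theorem memLp_scale_inv {ψ : ℝ → ℂ} (hψ : MemLp ψ 2 volume) :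
    MemLp (fun v => ψ (v * (2 * Real.pi))) 2 volume := by
  have h0 : (2 * Real.pi) ≠ 0 := by positivity
  refine MemLp.comp_of_map (g := ψ) (f := fun v : ℝ => v * (2 * Real.pi)) ?_ (by fun_prop)
  rw [Real.map_volume_mul_right h0]
  exact hψ.smul_measure (by finiteness)

theorem exists_hat_ae_eq (U : L2Transform) {ψ : ℝ → ℂ} (hψ : MemLp ψ 2 volume) :
    ∃ x : Lp ℂ 2 (volume : Measure ℝ), hat U x =ᵐ[volume] ψ := by
  have h0 : (2 * Real.pi) ≠ 0 := by positivity
  refine ⟨U.symm ((memLp_scale_inv hψ).toLp _), ?_⟩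
  filter_upwards [quasi_scale.ae_eq_comp (memLp_scale_inv hψ).coeFn_toLp] with lam hl
  simp only [Function.comp_apply, div_mul_cancel₀ _ h0] at hl
  rw [← hl, hat, LinearIsometryEquiv.apply_symm_apply]

/-- Plancherel's identity. -/
theorem inner_eq_integral_hat (U : L2Transform) (z x : Lp ℂ 2 (volume : Measure ℝ)) :
    inner ℂ z x =
      (1 / (2 * Real.pi) : ℂ) * ∫ lam, hat U x lam * (starRingEnd ℂ) (hat U z lam) := by
  rw [← U.inner_map_map, ← integral_scale]
  simp only [hat_mul_two_pi, L2.inner_def, RCLike.inner_apply]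

end Fourier

/-! ### Operators of kernel forms -/

theorem isClosed_L2On {T : Set ℝ} (hT : MeasurableSet T) :
    IsClosed (L2On T : Set (Lp ℂ 2 (volume : Measure ℝ))) := by
  have h : (L2On T : Set (Lp ℂ 2 (volume : Measure ℝ))) =
      (LinearMap.ker (LpToLpRestrictCLM ℝ ℂ ℂ volume 2 Tᶜ).toLinearMap : Set _) := by
    ext x
    simp only [SetLike.mem_coe, LinearMap.mem_ker, ContinuousLinearMap.coe_coe]
    rw [Lp.eq_zero_iff_ae_eq_zero]
    have h1 := LpToLpRestrictCLM_coeFn (F := ℂ) (p := 2) (μ := volume) ℂ Tᶜ x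
    have h2 : (x ∈ L2On T) ↔ x =ᵐ[volume.restrict Tᶜ] 0 := by
      rw [Filter.EventuallyEq, ae_restrict_iff' hT.compl]
      rfl
    rw [h2]
    exact ⟨h1.trans, h1.symm.trans⟩
  rw [h]
  exact (LpToLpRestrictCLM ℝ ℂ ℂ volume 2 Tᶜ).isClosed_ker

theorem completeSpace_L2On {T : Set ℝ} (hT : MeasurableSet T) : CompleteSpace (L2On T) :=
  (isClosed_L2On hT).completeSpace_coe

theorem weightedHat_mul_conj {σ : ℝ → ℝ} {lam : ℝ} (h0 : 0 ≤ σ lam) (U V : L2Transform)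
    (x z : Lp ℂ 2 (volume : Measure ℝ)) :
    weightedHat σ U x lam * (starRingEnd ℂ) (weightedHat σ V z lam) =
      σ lam * (hat U x lam * (starRingEnd ℂ) (hat V z lam)) := by
  have h : ((Real.sqrt (σ lam) : ℝ) : ℂ) * (Real.sqrt (σ lam) : ℝ) = (σ lam : ℝ) := by
    rw [← ofReal_mul, Real.mul_self_sqrt h0]
  simp only [weightedHat, map_mul, conj_ofReal]
  rw [← h]
  ring

theorem kernelForm_eq {σ : ℝ → ℝ} (h0 : ∀ lam, 0 ≤ σ lam) (U V : L2Transform)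
    (x z : Lp ℂ 2 (volume : Measure ℝ)) :
    kernelForm σ U V x z = (1 / (2 * Real.pi) : ℂ) *
      ∫ lam, σ lam * (hat U x lam * (starRingEnd ℂ) (hat V z lam)) := by
  simp only [kernelForm, weightedHat_mul_conj (h0 _)]

theorem memLp_mul_of_bounded {m : ℝ → ℝ} {ψ : ℝ → ℂ} {M : ℝ} (hm : AEMeasurable m)
    (h : ∀ᵐ lam, |m lam| ≤ M) (hψ : MemLp ψ 2 volume) :
    MemLp (fun lam => (m lam : ℂ) * ψ lam) 2 volume := by
  refine hψ.of_le_mul (c := M) ?_ ?_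
  · exact (Complex.measurable_ofReal.comp_aemeasurable hm).aestronglyMeasurable.mul hψ.1
  · filter_upwards [h] with lam hl
    rw [norm_mul, norm_real, Real.norm_eq_abs]
    gcongr

theorem memLp_weightedHat_of_bounded {σ : ℝ → ℝ} {M : ℝ} (hm : AEMeasurable σ)
    (h : ∀ᵐ lam, σ lam ≤ M) (U : L2Transform) (x : Lp ℂ 2 (volume : Measure ℝ)) :
    MemLp (weightedHat σ U x) 2 volume := by
  refine memLp_mul_of_bounded (M := Real.sqrt M) hm.sqrt ?_ (memLp_hat U x)
  filter_upwards [h] with lam hl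
  rw [abs_of_nonneg (Real.sqrt_nonneg _)]
  exact Real.sqrt_le_sqrt hl

/-- The operator of a form with bounded weight is defined everywhere. -/
theorem mem_domain_kernelOp_of_bounded {T : Set ℝ} (hT : MeasurableSet T) {σ : ℝ → ℝ} {M : ℝ}
    (h0 : ∀ lam, 0 ≤ σ lam) (hm : AEMeasurable σ) (h : ∀ᵐ lam, σ lam ≤ M) (U V : L2Transform)
    (x : L2On T) : x ∈ (kernelOp T σ U V).domain := by
  have := completeSpace_L2On hT
  have hb := fun W y => memLp_weightedHat_of_bounded hm h W y
  -- The value of the operator is the element of `L₂(ℝ)` with transform `σ x̂`, projected onto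
  -- `L₂(T)`; the projection does not change inner products with `z ∈ L₂(T)`.
  obtain ⟨y, hy⟩ := exists_hat_ae_eq V (memLp_mul_of_bounded hm (M := M)
    (h.mono fun lam hl => by rwa [abs_of_nonneg (h0 lam)]) (memLp_hat U x))
  rw [LinearPMap.mem_domain_iff]
  refine ⟨(L2On T).orthogonalProjectionOnto y, ?_⟩
  rw [kernelOp_graph]
  refine ⟨hb U x, ?_, fun z _ => ?_⟩
  · have : formDomain T σ V = ⊤ := eq_top_iff.2 fun z _ => hb V z
    rw [this]
    exact Submodule.le_topologicalClosure _ trivial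
  · rw [Submodule.inner_orthogonalProjectionOnto_eq_of_mem_left, inner_eq_integral_hat V,
      kernelForm_eq h0]
    congr 1
    refine integral_congr_ae ?_
    filter_upwards [hy] with lam hl
    rw [hl, mul_assoc]

theorem mem_kernelGraph {T : Set ℝ} {σ : ℝ → ℝ} {U V : L2Transform}
    (x : (kernelOp T σ U V).domain) :
    ((x : L2On T), kernelOp T σ U V x) ∈ kernelGraph T σ U V := by
  rw [← kernelOp_graph]
  exact (kernelOp T σ U V).mem_graph x

theorem inner_kernelOp {T : Set ℝ} {σ : ℝ → ℝ} {U V : L2Transform}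
    (x : (kernelOp T σ U V).domain) {z : L2On T} (hz : z ∈ formDomain T σ V) :
    inner ℂ z (kernelOp T σ U V x) = kernelForm σ U V (x : L2On T) z :=
  (mem_kernelGraph x).2.2 z hz

theorem pairing_eq_inner {T : Set ℝ} (hT : MeasurableSet T) (x y : L2On T) :
    pairing x y = inner ℂ y x := by
  rw [Submodule.coe_inner, L2.inner_def, pairing, ← integral_indicator hT]
  refine integral_congr_ae ?_
  filter_upwards [x.2] with t ht
  by_cases h : t ∈ T
  · simp [h, RCLike.inner_apply]
  · simp [h, ht h]

theorem kernelForm_eq_inner {σ : ℝ → ℝ} {U V : L2Transform} {x z : Lp ℂ 2 (volume : Measure ℝ)}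
    (hx : MemLp (weightedHat σ U x) 2 volume) (hz : MemLp (weightedHat σ V z) 2 volume) :
    kernelForm σ U V x z = (1 / (2 * Real.pi) : ℂ) * inner ℂ (hz.toLp _) (hx.toLp _) := by
  rw [kernelForm, L2.inner_def]
  congr 1
  refine integral_congr_ae ?_
  filter_upwards [hx.coeFn_toLp, hz.coeFn_toLp] with lam h1 h2
  rw [h1, h2, RCLike.inner_apply]

theorem kernelForm_conj (σ : ℝ → ℝ) (U V : L2Transform) (x z : Lp ℂ 2 (volume : Measure ℝ)) :
    (starRingEnd ℂ) (kernelForm σ U V x z) = kernelForm σ V U z x := by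
  unfold kernelForm
  rw [map_mul, ← integral_conj]
  congr 1
  · simp [Complex.conj_ofNat]
  · congr 1
    ext lam
    simp [mul_comm]

theorem inner_self_eq_ofReal {E : Type*} [NormedAddCommGroup E] [InnerProductSpace ℂ E] (x : E) :
    inner ℂ x x = ((‖x‖ ^ 2 : ℝ) : ℂ) := by
  rw [inner_self_eq_norm_sq_to_K]
  push_cast
  rfl

theorem norm_inner_self_eq {E : Type*} [NormedAddCommGroup E] [InnerProductSpace ℂ E] (x : E) :
    ‖inner ℂ x x‖ = ‖x‖ ^ 2 := by
  rw [inner_self_eq_ofReal, norm_real, Real.norm_of_nonneg (by positivity)]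

/-- If the operator of a form with `U = V` is invertible, the form is bounded below. -/
theorem exists_norm_sq_le {T : Set ℝ} (hT : MeasurableSet T) {σ : ℝ → ℝ} {U : L2Transform}
    (hB : IsInvertible (kernelOp T σ U U)) :
    ∃ C : ℝ, 0 ≤ C ∧ ∀ x : L2On T, ∀ hx : MemLp (weightedHat σ U x) 2 volume,
      ‖x‖ ^ 2 ≤ C * ‖hx.toLp _‖ ^ 2 := by
  have := completeSpace_L2On hT
  set B := kernelOp T σ U U
  let e := LinearEquiv.ofBijective B.toFun hB
  let G : L2On T →ₗ[ℂ] L2On T := B.domain.subtype ∘ₗ e.symm.toLinearMap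
  have hBe : ∀ y, B (e.symm y) = y := fun y => e.apply_symm_apply y
  have hGm : ∀ y, MemLp (weightedHat σ U (G y)) 2 volume := fun y =>
    (mem_kernelGraph (e.symm y)).1
  have hG : ∀ (y x : L2On T), MemLp (weightedHat σ U x) 2 volume →
      inner ℂ x y = kernelForm σ U U (G y) x := by
    intro y x hx
    have h := inner_kernelOp (e.symm y) (z := x) hx
    change inner ℂ x (B (e.symm y)) = _ at h
    rwa [hBe] at h
  -- The inverse `G` is defined everywhere and symmetric, because the form is Hermitian; by
  -- Hellinger–Toeplitz it is bounded.
  have hsym : G.IsSymmetric := by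
    intro y y'
    rw [hG y' (G y) (hGm y), ← inner_conj_symm y, hG y (G y') (hGm y'), kernelForm_conj]
  let G' : L2On T →L[ℂ] L2On T := ⟨G, hsym.continuous⟩
  have hp : (0 : ℝ) < 2 * Real.pi := by positivity
  have hn : ‖(1 / (2 * Real.pi) : ℂ)‖ = 1 / (2 * Real.pi) := by
    have : (1 / (2 * Real.pi) : ℂ) = ((1 / (2 * Real.pi) : ℝ) : ℂ) := by push_cast; ring
    rw [this, norm_real, Real.norm_of_nonneg (by positivity)]
  refine ⟨1 / (2 * Real.pi) * ‖G'‖, by positivity, fun x hx => ?_⟩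
  set q := (1 / (2 * Real.pi)) with hq
  have hq0 : 0 < q := by positivity
  set gx := (hGm x).toLp _
  set wx := hx.toLp _
  -- Cauchy–Schwarz for the form: `‖x‖²` is the form at `(G x, x)`. In the next bound the form at
  -- `(G x, G x)` is `⟨x, G x⟩`, controlled by `‖G'‖`. Eliminating `‖gx‖` leaves the claim
  -- multiplied by `‖x‖²`.
  have h1 : ‖x‖ ^ 2 ≤ q * (‖wx‖ * ‖gx‖) := by
    have h2 := hG x x hx
    rw [kernelForm_eq_inner (hGm x) hx] at h2
    rw [← norm_inner_self_eq x, h2, norm_mul, hn]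
    gcongr
    exact norm_inner_le_norm _ _
  have h2 : q * ‖gx‖ ^ 2 ≤ ‖G'‖ * ‖x‖ ^ 2 := by
    have h2 := hG x (G x) (hGm x)
    rw [kernelForm_eq_inner (hGm x) (hGm x)] at h2
    have h4 := congrArg norm h2
    rw [norm_mul, hn, norm_inner_self_eq gx] at h4
    rw [← h4]
    calc _ ≤ ‖G x‖ * ‖x‖ := norm_inner_le_norm _ _
      _ ≤ ‖G'‖ * ‖x‖ * ‖x‖ := by gcongr; exact G'.le_opNorm x
      _ = _ := by ring
  have h3 : (‖x‖ ^ 2) ^ 2 ≤ (q * ‖G'‖ * ‖wx‖ ^ 2) * ‖x‖ ^ 2 := by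
    calc _ ≤ (q * (‖wx‖ * ‖gx‖)) ^ 2 := by gcongr
      _ = q * ‖wx‖ ^ 2 * (q * ‖gx‖ ^ 2) := by ring
      _ ≤ q * ‖wx‖ ^ 2 * (‖G'‖ * ‖x‖ ^ 2) := by gcongr
      _ = _ := by ring
  rcases (sq_nonneg ‖x‖).eq_or_lt with h | h
  · rw [← h]; positivity
  · exact le_of_mul_le_mul_right (by linarith [sq (‖x‖ ^ 2)]) h

/-- The bound of `exists_norm_sq_le` in the frequency domain. -/
theorem exists_lintegral_hat_le {T : Set ℝ} (hT : MeasurableSet T) {σ : ℝ → ℝ} {U : L2Transform}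
    (h0 : ∀ lam, 0 ≤ σ lam) (hB : IsInvertible (kernelOp T σ U U)) :
    ∃ C : ℝ, 0 ≤ C ∧ ∀ x : L2On T, MemLp (weightedHat σ U x) 2 volume →
      ∫⁻ lam, ‖hat U x lam‖ₑ ^ 2 ≤
        ENNReal.ofReal C * ∫⁻ lam, ENNReal.ofReal (σ lam) * ‖hat U x lam‖ₑ ^ 2 := by
  obtain ⟨C, hC, h⟩ := exists_norm_sq_le hT hB
  -- The factor `2π` is Plancherel's: `∫ |x̂|² = 2π ‖x‖²`, while the weighted side carries no such
  -- factor.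
  refine ⟨2 * Real.pi * C, by positivity, fun x hx => ?_⟩
  have key : ∀ {ψ : ℝ → ℂ} (hψ : MemLp ψ 2 volume),
      ∫⁻ lam, ‖ψ lam‖ₑ ^ 2 = ENNReal.ofReal (∫ lam, ‖ψ lam‖ ^ 2) := by
    intro ψ hψ
    rw [ofReal_integral_eq_lintegral_ofReal ((memLp_two_iff_integrable_sq_norm hψ.1).1 hψ)
      (Filter.Eventually.of_forall fun _ => by positivity)]
    refine lintegral_congr fun lam => ?_
    rw [ENNReal.ofReal_pow (norm_nonneg _), ofReal_norm]
  have e1 : ∀ lam, ENNReal.ofReal (σ lam) * ‖hat U x lam‖ₑ ^ 2 = ‖weightedHat σ U x lam‖ₑ ^ 2 := by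
    intro lam
    rw [weightedHat, enorm_mul, mul_pow]
    congr 1
    rw [← ofReal_norm, norm_real, Real.norm_of_nonneg (Real.sqrt_nonneg _),
      ← ENNReal.ofReal_pow (Real.sqrt_nonneg _), Real.sq_sqrt (h0 lam)]
  simp only [e1]
  rw [key (memLp_hat U x), key hx, ← ENNReal.ofReal_mul (by positivity)]
  refine ENNReal.ofReal_le_ofReal ?_
  have h1 : ‖hx.toLp _‖ ^ 2 = ∫ lam, ‖weightedHat σ U x lam‖ ^ 2 := by
    have := L2.inner_def (𝕜 := ℂ) (hx.toLp _) (hx.toLp _)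
    rw [inner_self_eq_ofReal] at this
    have h2 : ∫ lam, (inner ℂ ((hx.toLp _ : Lp ℂ 2 volume) lam) (hx.toLp _ lam)) =
        ((∫ lam, ‖weightedHat σ U x lam‖ ^ 2 : ℝ) : ℂ) := by
      rw [← integral_complex_ofReal]
      refine integral_congr_ae ?_
      filter_upwards [hx.coeFn_toLp] with lam hl
      rw [hl, inner_self_eq_ofReal]
    rw [h2] at this
    exact ofReal_inj.1 this
  have h3 : ((∫ lam, ‖hat U x lam‖ ^ 2 : ℝ) : ℂ) = ((2 * Real.pi * ‖x‖ ^ 2 : ℝ) : ℂ) := by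
    have h4 := inner_eq_integral_hat U (x : Lp ℂ 2 (volume : Measure ℝ)) x
    rw [inner_self_eq_ofReal] at h4
    have h5 : ∫ lam, hat U x lam * (starRingEnd ℂ) (hat U x lam) =
        ((∫ lam, ‖hat U x lam‖ ^ 2 : ℝ) : ℂ) := by
      rw [← integral_complex_ofReal]
      refine integral_congr_ae (Filter.Eventually.of_forall fun lam => ?_)
      simp only [mul_conj, normSq_eq_norm_sq]
    rw [h5] at h4
    have hpi : (Real.pi : ℂ) ≠ 0 := by exact_mod_cast Real.pi_ne_zero
    have hn : ‖x‖ = ‖(x : Lp ℂ 2 (volume : Measure ℝ))‖ := rfl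
    rw [ofReal_mul, hn, h4]
    push_cast
    field_simp
  rw [ofReal_inj.1 h3, ← h1, mul_assoc (2 * Real.pi) C]
  exact mul_le_mul_of_nonneg_left (h x hx) (by positivity)

/-! ### The spaces `L₂(w)` -/

section Weighted

variable {w : ℝ → ℝ}

theorem IsSpectralDensity.aemeasurable_ofReal (hw : IsSpectralDensity w) :
    AEMeasurable fun lam => ENNReal.ofReal (w lam) :=
  hw.integrable.aemeasurable.ennreal_ofReal

theorem IsSpectralDensity.isFiniteMeasure (hw : IsSpectralDensity w) :
    IsFiniteMeasure (weighted w) :=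
  isFiniteMeasure_withDensity_ofReal hw.integrable.2

theorem integral_weighted (hw : IsSpectralDensity w) (F : ℝ → ℂ) :
    ∫ lam, F lam ∂weighted w = ∫ lam, w lam * F lam := by
  rw [weighted, integral_withDensity_eq_integral_toReal_smul₀ hw.aemeasurable_ofReal (by simp)]
  refine integral_congr_ae (Filter.Eventually.of_forall fun lam => ?_)
  simp [ENNReal.toReal_ofReal (hw.nonneg lam)]

theorem integrable_weighted_iff {E : Type*} [NormedAddCommGroup E] [NormedSpace ℝ E]
    (hw : IsSpectralDensity w) (F : ℝ → E) :
    Integrable F (weighted w) ↔ Integrable fun lam => w lam • F lam := by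
  rw [weighted, integrable_withDensity_iff_integrable_smul₀' hw.aemeasurable_ofReal (by simp)]
  refine integrable_congr (Filter.Eventually.of_forall fun lam => ?_)
  simp [ENNReal.toReal_ofReal (hw.nonneg lam)]

theorem memLp_weighted_iff (hw : IsSpectralDensity w) {ψ : ℝ → ℂ}
    (hψ : AEStronglyMeasurable ψ (weighted w)) :
    MemLp ψ 2 (weighted w) ↔ Integrable fun lam => w lam * ‖ψ lam‖ ^ 2 := by
  rw [memLp_two_iff_integrable_sq_norm hψ, integrable_weighted_iff hw]
  rfl

theorem weighted_absolutelyContinuous : weighted w ≪ volume :=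
  withDensity_absolutelyContinuous _ _

/-- Together with `weighted_absolutelyContinuous`, this makes the null sets of `L₂(w)` those of
Lebesgue measure, so pointwise identities pass freely between the two. -/
theorem IsSpectralDensity.absolutelyContinuous (hw : IsSpectralDensity w)
    (hpos : ∀ᵐ lam, 0 < w lam) : volume ≪ weighted w :=
  withDensity_absolutelyContinuous' hw.aemeasurable_ofReal
    (hpos.mono fun lam h => by simpa using h)

theorem inner_weighted (hw : IsSpectralDensity w) (φ ψ : Lp ℂ 2 (weighted w)) :
    inner ℂ φ ψ = ∫ lam, w lam * (ψ lam * (starRingEnd ℂ) (φ lam)) := by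
  rw [L2.inner_def, integral_weighted hw]
  simp only [RCLike.inner_apply]

theorem memLp_exp (hw : IsSpectralDensity w) (t : ℝ) :
    MemLp (fun lam : ℝ => exp (I * t * lam)) 2 (weighted w) := by
  have := hw.isFiniteMeasure
  refine MemLp.of_bound (by fun_prop) 1 (Filter.Eventually.of_forall fun lam => ?_)
  have : I * t * lam = ((t * lam : ℝ) : ℂ) * I := by push_cast; ring
  rw [this, norm_exp_ofReal_mul_I]

/-- The class of `λ ↦ e^{itλ}` in `L₂(w)`. -/
def harmonic (hw : IsSpectralDensity w) (t : ℝ) : Lp ℂ 2 (weighted w) := (memLp_exp hw t).toLp _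

theorem isHarmonic_iff (hw : IsSpectralDensity w) (t : ℝ) (φ : Lp ℂ 2 (weighted w)) :
    IsHarmonic w t φ ↔ φ = harmonic hw t := by
  constructor
  · intro h
    exact Lp.ext (h.trans (memLp_exp hw t).coeFn_toLp.symm)
  · rintro rfl
    exact (memLp_exp hw t).coeFn_toLp

theorem harmonicSpan_eq (hw : IsSpectralDensity w) (U : Set ℝ) :
    harmonicSpan w U = (Submodule.span ℂ (harmonic hw '' U)).topologicalClosure := by
  rw [harmonicSpan]
  congr 2
  ext φ
  simp only [isHarmonic_iff hw, Set.mem_ofPred_eq, Set.mem_image]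
  exact ⟨fun ⟨t, ht, h⟩ => ⟨t, ht, h.symm⟩, fun ⟨t, ht, h⟩ => ⟨t, ht, h.symm⟩⟩

theorem conj_exp_I_mul (t lam : ℝ) :
    (starRingEnd ℂ) (exp (I * t * lam)) = exp (-(I * t * lam)) := by
  rw [← exp_conj]
  simp

theorem norm_exp_neg_I_mul (t lam : ℝ) : ‖exp (-(I * t * lam))‖ = 1 := by
  have : -(I * t * lam) = ((-(t * lam) : ℝ) : ℂ) * I := by push_cast; ring
  rw [this, norm_exp_ofReal_mul_I]

theorem inner_harmonic_left (hw : IsSpectralDensity w) (t : ℝ) (φ : Lp ℂ 2 (weighted w)) :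
    inner ℂ (harmonic hw t) φ = ∫ lam : ℝ, (w lam * φ lam) * exp (-(I * t * lam)) := by
  rw [L2.inner_def]
  have h : (fun lam => inner ℂ ((harmonic hw t : Lp ℂ 2 (weighted w)) lam) (φ lam))
      =ᵐ[weighted w] fun lam => φ lam * exp (-(I * t * lam)) := by
    filter_upwards [(memLp_exp hw t).coeFn_toLp] with lam hl
    rw [harmonic, hl, RCLike.inner_apply, conj_exp_I_mul]
  rw [integral_congr_ae h, integral_weighted hw]
  simp only [mul_assoc]

theorem inner_harmonic_harmonic (hw : IsSpectralDensity w) (s t : ℝ) :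
    inner ℂ (harmonic hw s) (harmonic hw t) = ∫ lam : ℝ, exp (I * (t - s) * lam) * w lam := by
  rw [L2.inner_def]
  have h : (fun lam => inner ℂ ((harmonic hw s : Lp ℂ 2 (weighted w)) lam)
      ((harmonic hw t : Lp ℂ 2 (weighted w)) lam))
      =ᵐ[weighted w] fun lam : ℝ => exp (I * (t - s) * lam) := by
    filter_upwards [(memLp_exp hw t).coeFn_toLp, (memLp_exp hw s).coeFn_toLp] with lam h1 h2
    rw [harmonic, harmonic, h1, h2, RCLike.inner_apply, conj_exp_I_mul, ← exp_add]
    congr 1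
    ring
  rw [integral_congr_ae h, integral_weighted hw]
  simp only [mul_comm]

/-- The measure `w dλ` is finite, so `L₂(w) ⊆ L₁(w)`. -/
theorem integrable_weighted_mul (hw : IsSpectralDensity w) (φ : Lp ℂ 2 (weighted w)) :
    Integrable fun lam => (w lam : ℂ) * φ lam := by
  have := hw.isFiniteMeasure
  have h : Integrable φ (weighted w) := (Lp.memLp φ).integrable (by norm_num)
  simpa using (integrable_weighted_iff hw _).1 h

/-- An integrable function with vanishing Fourier integrals is zero. -/
theorem ae_eq_zero_of_integral_exp {β : ℝ → ℂ} (hβ : Integrable β)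
    (h : ∀ t : ℝ, ∫ lam : ℝ, β lam * exp (-(I * t * lam)) = 0) : β =ᵐ[volume] 0 := by
  refine ae_eq_zero_of_fourier hβ fun v => ?_
  have h0 : (2 * Real.pi) ≠ 0 := by positivity
  have h1 := fourier_div_two_pi β (v * (2 * Real.pi))
  rw [mul_div_cancel_right₀ _ h0] at h1
  rw [h1, ← h (v * (2 * Real.pi))]
  simp only [mul_right_comm I]

/-- The functions `e^{itλ}`, `t ∈ ℝ`, are total in `L₂(w)`. -/
theorem harmonicSpan_univ (hw : IsSpectralDensity w) : harmonicSpan w Set.univ = ⊤ := by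
  rw [harmonicSpan_eq hw, Submodule.topologicalClosure_eq_top_iff, Submodule.eq_bot_iff]
  intro φ hφ
  -- For `φ` orthogonal to all harmonics, the integrable function `w φ` has vanishing Fourier
  -- transform.
  have h := ae_eq_zero_of_integral_exp (integrable_weighted_mul hw φ) fun t => by
    rw [← inner_harmonic_left hw]
    exact (Submodule.mem_orthogonal _ _).1 hφ _
      (Submodule.subset_span (Set.mem_image_of_mem _ (Set.mem_univ t)))
  refine Lp.eq_zero_iff_ae_eq_zero.2 ((ae_withDensity_iff' hw.aemeasurable_ofReal).2 ?_)
  filter_upwards [h] with lam hl h0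
  have h1 : w lam ≠ 0 := fun h => h0 (by simp [h])
  simpa [h1] using hl

end Weighted

/-! ### Consequences of the minimality condition -/

theorem gammaOf_eq_integral_indicator (α : ℝ → ℂ) (lam : ℝ) :
    gammaOf α lam = ∫ u : ℝ, (Set.Ioi (0 : ℝ)).indicator α u * exp (I * u * lam) := by
  rw [gammaOf, ← integral_indicator measurableSet_Ioi]
  refine integral_congr_ae (Filter.Eventually.of_forall fun u => ?_)
  by_cases h : u ∈ Set.Ioi (0 : ℝ) <;> simp [h]

theorem norm_gammaOf_le (α : ℝ → ℂ) (lam : ℝ) :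
    ‖gammaOf α lam‖ ≤ ∫ t in Set.Ioi (0 : ℝ), ‖α t‖ := by
  refine (norm_integral_le_integral_norm _).trans_eq ?_
  refine integral_congr_ae (Filter.Eventually.of_forall fun t => ?_)
  have : I * t * lam = ((t * lam : ℝ) : ℂ) * I := by push_cast; ring
  simp only [norm_mul, this, norm_exp_ofReal_mul_I, mul_one]

theorem IsExponentialType.continuous {γ : ℝ → ℂ} (h : IsExponentialType γ) : Continuous γ := by
  obtain ⟨F, hF, -, hγ⟩ := h
  have : γ = fun lam : ℝ => F lam := funext fun lam => (hγ lam).symm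
  rw [this]
  exact hF.continuous.comp continuous_ofReal

/-- A nontrivial entire function has almost no real zeros. -/
theorem IsExponentialType.ae_ne_zero {γ : ℝ → ℂ} (h : IsExponentialType γ)
    (h0 : ∃ lam, γ lam ≠ 0) : ∀ᵐ lam, γ lam ≠ 0 := by
  obtain ⟨F, hF, -, hγ⟩ := h
  obtain ⟨l0, hl0⟩ := h0
  have hana : AnalyticOnNhd ℂ F Set.univ := fun z _ => hF.analyticAt z
  rw [ae_iff]
  simp only [not_not]
  -- Zeros of a nonzero entire function are isolated, so near each real point the zero set is
  -- contained in that point.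
  refine measure_null_of_locally_null _ fun lam _ => ?_
  have h1 : ∀ᶠ z in nhdsWithin (lam : ℂ) {(lam : ℂ)}ᶜ, F z ≠ 0 := by
    by_contra hf
    have := hana.eqOn_zero_of_preconnected_of_frequently_eq_zero isPreconnected_univ
      (Set.mem_univ (lam : ℂ)) hf
    exact hl0 (by rw [← hγ]; exact this (Set.mem_univ _))
  have h2 : ∀ᶠ t in nhdsWithin lam {lam}ᶜ, γ t ≠ 0 := by
    have ht : Filter.Tendsto (fun t : ℝ => (t : ℂ)) (nhdsWithin lam {lam}ᶜ)
        (nhdsWithin (lam : ℂ) {(lam : ℂ)}ᶜ) := by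
      refine continuous_ofReal.continuousWithinAt.tendsto_nhdsWithin fun t ht => ?_
      simpa using ht
    filter_upwards [ht.eventually h1] with t h3
    rwa [← hγ]
  refine ⟨{lam}, ?_, by simp⟩
  rw [mem_nhdsWithin_iff_eventually]
  rw [eventually_nhdsWithin_iff] at h2
  filter_upwards [h2] with t ht hz
  by_contra hne
  exact ht hne hz

/-- Where `w = 0` and `γ ≠ 0` the quotient is infinite, which a finite integral allows only on a
null set. -/
theorem ae_pos_of_lintegral_lt_top {γ : ℝ → ℂ} {w : ℝ → ℝ} (hγ : AEMeasurable γ)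
    (hw : AEMeasurable w) (h0 : ∀ᵐ lam, γ lam ≠ 0)
    (h : ∫⁻ lam, ‖γ lam‖ₑ ^ 2 / ENNReal.ofReal (w lam) < ⊤) : ∀ᵐ lam, 0 < w lam := by
  filter_upwards [h0, ae_lt_top' ((hγ.enorm.pow_const 2).div hw.ennreal_ofReal) h.ne] with lam h1 h2
  by_contra hn
  rw [Pi.div_apply, ENNReal.ofReal_of_nonpos (not_lt.1 hn),
    ENNReal.div_zero (by simpa using h1)] at h2
  exact lt_irrefl _ h2

theorem integrable_of_lintegral_lt_top {γ : ℝ → ℂ} {w : ℝ → ℝ} (hγ : AEMeasurable γ)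
    (hw : AEMeasurable w) (hpos : ∀ᵐ lam, 0 < w lam)
    (h : ∫⁻ lam, ‖γ lam‖ₑ ^ 2 / ENNReal.ofReal (w lam) < ⊤) :
    Integrable fun lam => ‖γ lam‖ ^ 2 / w lam := by
  refine ⟨((hγ.norm.pow_const 2).div hw).aestronglyMeasurable, ?_⟩
  rw [hasFiniteIntegral_iff_enorm]
  refine (lintegral_congr_ae ?_).trans_lt h
  filter_upwards [hpos] with lam hl
  rw [← ofReal_norm, Real.norm_of_nonneg (by positivity), ENNReal.ofReal_div_of_pos hl,
    ENNReal.ofReal_pow (norm_nonneg _), ofReal_norm]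

/-- From `2|γ| ≤ |γ|² / w + w` the function `γ` is integrable; being bounded as well, it is square
integrable. -/
theorem memLp_two_of_integrable_div {γ : ℝ → ℂ} {w : ℝ → ℝ} (hw : IsSpectralDensity w)
    (hc : Continuous γ) {M : ℝ} (hM : ∀ lam, ‖γ lam‖ ≤ M)
    (hpos : ∀ᵐ lam, 0 < w lam) (h : Integrable fun lam => ‖γ lam‖ ^ 2 / w lam) :
    MemLp γ 2 volume := by
  have h1 : Integrable γ := by
    refine (h.add hw.integrable).mono' hc.aestronglyMeasurable ?_
    filter_upwards [hpos] with lam hl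
    have h2 : ‖γ lam‖ ^ 2 / w lam + w lam - 2 * ‖γ lam‖ = (‖γ lam‖ - w lam) ^ 2 / w lam := by
      field_simp
      ring
    have h3 : 0 ≤ (‖γ lam‖ - w lam) ^ 2 / w lam := by positivity
    simp only [Pi.add_apply]
    linarith [norm_nonneg (γ lam)]
  rw [memLp_two_iff_integrable_sq_norm hc.aestronglyMeasurable]
  refine (h1.norm.const_mul M).mono' (by fun_prop) (Filter.Eventually.of_forall fun lam => ?_)
  rw [Real.norm_of_nonneg (by positivity), sq]
  exact mul_le_mul_of_nonneg_right (hM lam) (norm_nonneg _)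

/-- Forward translates of `α` lie in `L₂(T)`. -/
theorem exists_L2On_hat_shift {T : Set ℝ} (hT : Set.Ici 0 ⊆ T) {α : ℝ → ℂ}
    (hα : IntegrableOn α (Set.Ioi 0)) (hγ : MemLp (gammaOf α) 2 volume) {t : ℝ} (ht : 0 ≤ t) :
    ∃ x : L2On T, hat plusTransform x =ᵐ[volume] fun lam : ℝ =>
      exp (I * t * lam) * gammaOf α lam := by
  have hexp : ∀ lam : ℝ, ‖exp (I * t * lam)‖ = 1 := fun lam => by
    have : I * t * lam = ((t * lam : ℝ) : ℂ) * I := by push_cast; ring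
    rw [this, norm_exp_ofReal_mul_I]
  have hm : MemLp (fun lam : ℝ => exp (I * t * lam) * gammaOf α lam) 2 volume := by
    refine hγ.of_le (((by fun_prop : Continuous fun lam : ℝ =>
      exp (I * t * lam)).aestronglyMeasurable).mul hγ.1) (Filter.Eventually.of_forall fun lam => ?_)
    rw [norm_mul, hexp, one_mul]
  -- Only `α ∈ L₁` is given. Square integrability comes from the transform side, and uniqueness of
  -- transforms then identifies `x` with the translate of `α` by `t`.
  obtain ⟨x, hx⟩ := exists_hat_ae_eq plusTransform hm
  set β : ℝ → ℂ := fun u => (Set.Ioi (0 : ℝ)).indicator α (u - t)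
  have hβ : Integrable β := (hα.integrable_indicator measurableSet_Ioi).comp_sub_right t
  have h1 : x =ᵐ[volume] β := by
    refine ae_eq_of_hat_plus hβ (hx.trans (Filter.Eventually.of_forall fun lam => ?_))
    simp only [β]
    rw [gammaOf_eq_integral_indicator, ← integral_const_mul, ← integral_sub_right_eq_self _ t]
    refine integral_congr_ae (Filter.Eventually.of_forall fun u => ?_)
    simp only
    rw [mul_left_comm, ← exp_add]
    congr 2
    push_cast
    ring
  refine ⟨⟨x, ?_⟩, hx⟩
  filter_upwards [h1] with u hu hn
  rw [hu]
  have : u < 0 := by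
    by_contra h
    exact hn (hT (not_lt.1 h))
  exact Set.indicator_of_notMem (by simp; linarith) _

theorem eLpNorm_two_sq (F : ℝ → ℂ) (μ : Measure ℝ) :
    eLpNorm F 2 μ ^ 2 = ∫⁻ lam, ‖F lam‖ₑ ^ 2 ∂μ := by
  have h := eLpNorm_nnreal_pow_eq_lintegral (f := F) (μ := μ) (p := 2) (by norm_num)
  norm_num at h
  exact h

theorem lintegral_weighted {w : ℝ → ℝ} (hw : AEMeasurable w) (F : ℝ → ENNReal) :
    ∫⁻ lam, F lam ∂weighted w = ∫⁻ lam, ENNReal.ofReal (w lam) * F lam := by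
  rw [weighted, lintegral_withDensity_eq_lintegral_mul_non_measurable₀ _ hw.ennreal_ofReal
    (Filter.Eventually.of_forall fun _ => ENNReal.ofReal_lt_top)]
  rfl

theorem weighted_mono {k w : ℝ → ℝ} (h : ∀ lam, k lam ≤ w lam) : weighted k ≤ weighted w :=
  withDensity_mono (Filter.Eventually.of_forall fun lam => ENNReal.ofReal_le_ofReal (h lam))

/-- An inequality between weighted norms that holds for trigonometric polynomials
holds between the weights. -/
theorem weighted_le_of_harmonic {k₁ k₂ v : ℝ → ℝ} (hv : IsSpectralDensity v)
    (h₁ : ∀ lam, k₁ lam ≤ v lam) (h₂ : ∀ lam, k₂ lam ≤ v lam) {c : NNReal}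
    (h : ∀ p ∈ Submodule.span ℂ (harmonic hv '' Set.univ),
      eLpNorm p 2 (weighted k₁) ≤ c * eLpNorm p 2 (weighted k₂))
    {E : Set ℝ} (hE : MeasurableSet E) :
    weighted k₁ E ≤ c ^ 2 * weighted k₂ E := by
  have := hv.isFiniteMeasure
  set φ : Lp ℂ 2 (weighted v) := indicatorConstLp 2 hE (measure_ne_top _ _) 1
  have hcl : φ ∈ closure
      (Submodule.span ℂ (harmonic hv '' Set.univ) : Set (Lp ℂ 2 (weighted v))) := by
    have h1 := harmonicSpan_univ hv
    rw [harmonicSpan_eq hv] at h1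
    rw [← Submodule.topologicalClosure_coe, h1]
    trivial
  have hac₁ : weighted k₁ ≪ weighted v := (weighted_mono h₁).absolutelyContinuous
  have hac₂ : weighted k₂ ≪ weighted v := (weighted_mono h₂).absolutelyContinuous
  have key : eLpNorm φ 2 (weighted k₁) ≤ c * eLpNorm φ 2 (weighted k₂) := by
    refine ENNReal.le_of_forall_pos_le_add fun ε hε _ => ?_
    -- Approximation in `L₂(v)` controls both seminorms, since `k₁, k₂ ≤ v`. The error `δ` enters
    -- once directly and once multiplied by `c`, hence `ε / (c + 1)`.
    obtain ⟨p, hp, hd⟩ := EMetric.mem_closure_iff.1 hcl (ε / (c + 1) : NNReal) (by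
      have : 0 < ε / (c + 1) := by positivity
      exact_mod_cast this)
    rw [Lp.edist_def] at hd
    set δ : NNReal := ε / (c + 1)
    have hφ := Lp.aestronglyMeasurable φ
    have hpm := Lp.aestronglyMeasurable p
    have e1 : eLpNorm φ 2 (weighted k₁) ≤ eLpNorm p 2 (weighted k₁) + δ := by
      calc eLpNorm φ 2 (weighted k₁) = eLpNorm (p + (φ - p) : ℝ → ℂ) 2 (weighted k₁) := by
            congr 1; ext; simp
        _ ≤ eLpNorm p 2 (weighted k₁) + eLpNorm (φ - p : ℝ → ℂ) 2 (weighted k₁) :=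
            eLpNorm_add_le (hpm.mono_ac hac₁) ((hφ.sub hpm).mono_ac hac₁) (by norm_num)
        _ ≤ _ := by
            gcongr
            exact (eLpNorm_mono_measure _ (weighted_mono h₁)).trans hd.le
    have e2 : eLpNorm p 2 (weighted k₂) ≤ eLpNorm φ 2 (weighted k₂) + δ := by
      calc eLpNorm p 2 (weighted k₂) = eLpNorm (φ - (φ - p) : ℝ → ℂ) 2 (weighted k₂) := by
            congr 1; ext; simp
        _ ≤ eLpNorm φ 2 (weighted k₂) + eLpNorm (φ - p : ℝ → ℂ) 2 (weighted k₂) :=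
            eLpNorm_sub_le (hφ.mono_ac hac₂) ((hφ.sub hpm).mono_ac hac₂) (by norm_num)
        _ ≤ _ := by
            gcongr
            exact (eLpNorm_mono_measure _ (weighted_mono h₂)).trans hd.le
    have e3 : (c * δ + δ : ENNReal) = ε := by
      have : c * δ + δ = ε := by simp only [δ]; field_simp
      exact_mod_cast this
    calc eLpNorm φ 2 (weighted k₁) ≤ c * eLpNorm p 2 (weighted k₂) + δ := e1.trans (by
            gcongr; exact h p hp)
      _ ≤ c * (eLpNorm φ 2 (weighted k₂) + δ) + δ := by gcongr
      _ = c * eLpNorm φ 2 (weighted k₂) + ε := by rw [mul_add, add_assoc, e3]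
  have hsq : ∀ {μ : Measure ℝ}, μ ≪ weighted v → eLpNorm φ 2 μ ^ 2 = μ E := by
    intro μ hμ
    rw [eLpNorm_two_sq]
    have h3 : ∀ᵐ lam ∂μ, ‖φ lam‖ₑ ^ 2 = E.indicator (fun _ => 1) lam := by
      filter_upwards [hμ.ae_le (indicatorConstLp_coeFn (p := 2) (hs := hE)
        (hμs := measure_ne_top (weighted v) E) (c := (1 : ℂ)))] with lam hl
      simp only [φ, hl]
      by_cases hm : lam ∈ E <;> simp [hm]
    rw [lintegral_congr_ae h3, lintegral_indicator hE]
    simp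
  rw [← hsq hac₁, ← hsq hac₂, ← mul_pow]
  gcongr

theorem MinimalityCondition.ae_pos {f g : ℝ → ℝ} (hmin : MinimalityCondition f g)
    (hw : IsSpectralDensity (f + g)) : ∀ᵐ lam, 0 < f lam + g lam := by
  obtain ⟨α, -, hexp, hne, hlt⟩ := hmin
  exact ae_pos_of_lintegral_lt_top hexp.continuous.aemeasurable hw.integrable.aemeasurable
    (hexp.ae_ne_zero hne) hlt

theorem memLp_weightedHat_iff {σ : ℝ → ℝ} (h0 : ∀ lam, 0 ≤ σ lam) (hm : AEMeasurable σ)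
    (U : L2Transform) (x : Lp ℂ 2 (volume : Measure ℝ)) :
    MemLp (weightedHat σ U x) 2 volume ↔ Integrable fun lam => σ lam * ‖hat U x lam‖ ^ 2 := by
  have h1 : AEStronglyMeasurable (weightedHat σ U x) volume :=
    (Complex.measurable_ofReal.comp_aemeasurable hm.sqrt).aestronglyMeasurable.mul (memLp_hat U x).1
  rw [memLp_two_iff_integrable_sq_norm h1]
  refine integrable_congr (Filter.Eventually.of_forall fun lam => ?_)
  simp only [weightedHat, norm_mul, norm_real, Real.norm_of_nonneg (Real.sqrt_nonneg _), mul_pow,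
    Real.sq_sqrt (h0 lam)]

/-- Under the minimality condition, invertibility of `B` forces the density to be bounded. -/
theorem MinimalityCondition.exists_ae_le {f g : ℝ → ℝ} (hmin : MinimalityCondition f g)
    (hw : IsSpectralDensity (f + g)) {T : Set ℝ} (hTm : MeasurableSet T) (hT : Set.Ici 0 ⊆ T)
    (hB : IsInvertible (opB T f g)) : ∃ M : ℝ, ∀ᵐ lam, f lam + g lam ≤ M := by
  have hpos := hmin.ae_pos hw
  obtain ⟨α, hα, hexp, hne, hlt⟩ := hmin
  set γ := gammaOf α
  set w : ℝ → ℝ := f + g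
  have hwm : AEMeasurable w := hw.integrable.aemeasurable
  have hγ0 := hexp.ae_ne_zero hne
  have hγc := hexp.continuous
  have hdiv : Integrable fun lam => ‖γ lam‖ ^ 2 / w lam :=
    integrable_of_lintegral_lt_top hγc.aemeasurable hwm hpos hlt
  have hγ : MemLp γ 2 volume := memLp_two_of_integrable_div hw hγc (norm_gammaOf_le α) hpos hdiv
  have hsq : Integrable fun lam => ‖γ lam‖ ^ 2 :=
    (memLp_two_iff_integrable_sq_norm hγ.1).1 hγ
  set k₁ : ℝ → ℝ := fun lam => ‖γ lam‖ ^ 2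
  set k₂ : ℝ → ℝ := fun lam => ‖γ lam‖ ^ 2 / w lam
  -- An integrable weight dominating both `k₁` and `k₂`, in whose `L₂` space the approximation takes
  -- place. It is positive wherever `γ ≠ 0`.
  set v : ℝ → ℝ := fun lam => k₁ lam + k₂ lam
  have hk₁ : ∀ lam, 0 ≤ k₁ lam := fun lam => by positivity
  have hk₂ : ∀ lam, 0 ≤ k₂ lam := fun lam => div_nonneg (by positivity) (hw.nonneg lam)
  have hv : IsSpectralDensity v := ⟨fun lam => add_nonneg (hk₁ lam) (hk₂ lam), hsq.add hdiv⟩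
  have hvpos : ∀ᵐ lam, 0 < v lam := by
    filter_upwards [hγ0] with lam h1
    exact add_pos_of_pos_of_nonneg (by positivity) (hk₂ lam)
  have hac := hv.absolutelyContinuous hvpos
  have hσ0 : ∀ lam, 0 ≤ 1 / w lam := fun lam => div_nonneg zero_le_one (hw.nonneg lam)
  have hσm : AEMeasurable fun lam => 1 / w lam := hwm.const_div 1
  obtain ⟨C, hC, hCB⟩ := exists_lintegral_hat_le hTm hσ0 hB
  -- A harmonic `e^{itλ}` with `t < 0` would shift `α` out of `[0, ∞)`. An extra factor `e^{isλ}`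
  -- with `s` large makes every shift nonnegative. The claim for all large `s` lets the two summands
  -- of a sum share one `s`.
  have hspan : ∀ p ∈ Submodule.span ℂ (harmonic hv '' Set.univ), ∃ s₀ : ℝ, ∀ s ≥ s₀, ∃ x : L2On T,
      hat plusTransform x =ᵐ[volume] fun lam : ℝ => exp (I * s * lam) * p lam * γ lam := by
    intro p hp
    induction hp using Submodule.span_induction with
    | mem p hp =>
      obtain ⟨t, -, rfl⟩ := hp
      refine ⟨-t, fun s hs => ?_⟩
      obtain ⟨x, hx⟩ := exists_L2On_hat_shift hT hα hγ (t := s + t) (by linarith)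
      refine ⟨x, hx.trans ?_⟩
      filter_upwards [hac.ae_le (memLp_exp hv t).coeFn_toLp] with lam hl
      rw [harmonic, hl, ← exp_add]
      congr 2
      push_cast
      ring
    | zero =>
      refine ⟨0, fun s _ => ⟨0, ?_⟩⟩
      have h0 := hat_smul plusTransform 0 (0 : Lp ℂ 2 (volume : Measure ℝ))
      filter_upwards [h0, hac.ae_le (Lp.coeFn_zero ℂ 2 (weighted v))] with lam h1 h2
      rw [zero_smul] at h1
      simp only [Submodule.coe_zero]
      rw [h1, h2]
      simp
    | add p q _ _ hp hq =>
      obtain ⟨s₁, h₁⟩ := hp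
      obtain ⟨s₂, h₂⟩ := hq
      refine ⟨max s₁ s₂, fun s hs => ?_⟩
      obtain ⟨x, hx⟩ := h₁ s (le_trans (le_max_left _ _) hs)
      obtain ⟨y, hy⟩ := h₂ s (le_trans (le_max_right _ _) hs)
      refine ⟨x + y, ?_⟩
      filter_upwards [hat_add plusTransform (x : Lp ℂ 2 (volume : Measure ℝ)) y, hx, hy,
        hac.ae_le (Lp.coeFn_add p q)] with lam e1 e2 e3 e4
      simp only [Submodule.coe_add]
      rw [e1, e2, e3, e4, Pi.add_apply]
      ring
    | smul c p _ hp =>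
      obtain ⟨s₁, h₁⟩ := hp
      refine ⟨s₁, fun s hs => ?_⟩
      obtain ⟨x, hx⟩ := h₁ s hs
      refine ⟨c • x, ?_⟩
      filter_upwards [hat_smul plusTransform c (x : Lp ℂ 2 (volume : Measure ℝ)), hx,
        hac.ae_le (Lp.coeFn_smul c p)] with lam e1 e2 e3
      simp only [Submodule.coe_smul]
      rw [e1, e2, e3, Pi.smul_apply, smul_eq_mul]
      ring
  have hexp1 : ∀ s lam : ℝ, ‖exp (I * s * lam)‖ = 1 := fun s lam => by
    have : I * s * lam = ((s * lam : ℝ) : ℂ) * I := by push_cast; ring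
    rw [this, norm_exp_ofReal_mul_I]
  set c : NNReal := Real.toNNReal (Real.sqrt C)
  have hc2 : (c : ENNReal) ^ 2 = ENNReal.ofReal C := by
    change ENNReal.ofReal (Real.sqrt C) ^ 2 = _
    rw [← ENNReal.ofReal_pow (Real.sqrt_nonneg _), Real.sq_sqrt hC]
  -- The lower bound for the form at `x̂ = e^{isλ} p γ`; the factor `e^{isλ}` has modulus one and
  -- drops out. The form is finite at `x` because `p ∈ L₂(v)` and `k₂ ≤ v`.
  have hineq : ∀ p ∈ Submodule.span ℂ (harmonic hv '' Set.univ),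
      eLpNorm p 2 (weighted k₁) ≤ c * eLpNorm p 2 (weighted k₂) := by
    intro p hp
    obtain ⟨s, hs⟩ := hspan p hp
    obtain ⟨x, hx⟩ := hs s le_rfl
    have hn : ∀ᵐ lam, ‖hat plusTransform x lam‖ = ‖p lam‖ * ‖γ lam‖ := by
      filter_upwards [hx] with lam hl
      rw [hl, norm_mul, norm_mul, hexp1, one_mul]
    have hxm : MemLp (weightedHat (fun lam => 1 / w lam) plusTransform x) 2 volume := by
      rw [memLp_weightedHat_iff hσ0 hσm]
      have hp2 := (memLp_weighted_iff hv (Lp.memLp p).1).1 (Lp.memLp p)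
      refine hp2.mono' (hσm.aestronglyMeasurable.mul ((memLp_hat _ _).1.norm.pow 2)) ?_
      filter_upwards [hn] with lam hl
      rw [Real.norm_of_nonneg (mul_nonneg (hσ0 lam) (by positivity)), hl]
      have : 1 / w lam * (‖p lam‖ * ‖γ lam‖) ^ 2 = k₂ lam * ‖p lam‖ ^ 2 := by
        simp only [k₂]; ring
      rw [this]
      exact mul_le_mul_of_nonneg_right (le_add_of_nonneg_left (hk₁ lam)) (by positivity)
    have h := hCB x hxm
    rw [← hc2] at h
    have e1 : ∫⁻ lam, ‖hat plusTransform x lam‖ₑ ^ 2 = eLpNorm p 2 (weighted k₁) ^ 2 := by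
      rw [eLpNorm_two_sq, lintegral_weighted hsq.aemeasurable]
      refine lintegral_congr_ae ?_
      filter_upwards [hn] with lam hl
      rw [← ofReal_norm, hl, ENNReal.ofReal_mul (norm_nonneg _), mul_pow, ofReal_norm,
        ← ENNReal.ofReal_pow (norm_nonneg _), mul_comm]
    have e2 : ∫⁻ lam, ENNReal.ofReal (1 / w lam) * ‖hat plusTransform x lam‖ₑ ^ 2 =
        eLpNorm p 2 (weighted k₂) ^ 2 := by
      rw [eLpNorm_two_sq, lintegral_weighted hdiv.aemeasurable]
      refine lintegral_congr_ae ?_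
      filter_upwards [hn] with lam hl
      simp only [k₂]
      rw [← ofReal_norm, hl, ENNReal.ofReal_mul (norm_nonneg _), mul_pow, ofReal_norm,
        ← ENNReal.ofReal_pow (norm_nonneg _), mul_left_comm, ← ENNReal.ofReal_mul (hσ0 lam),
        one_div_mul_eq_div, mul_comm]
    rw [e1, e2, ← mul_pow] at h
    exact (ENNReal.pow_le_pow_left_iff two_ne_zero).1 h
  have hE := fun E (hE : MeasurableSet E) => weighted_le_of_harmonic (k₁ := k₁) (k₂ := k₂) hv
    (fun lam => le_add_of_nonneg_right (hk₂ lam)) (fun lam => le_add_of_nonneg_left (hk₁ lam))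
    hineq hE
  have hae : (fun lam => ENNReal.ofReal (k₁ lam)) ≤ᵐ[volume]
      fun lam => ENNReal.ofReal C * ENNReal.ofReal (k₂ lam) := by
    refine ae_le_of_forall_setLIntegral_le_of_sigmaFinite₀ hsq.aemeasurable.ennreal_ofReal
      fun E hEm _ => ?_
    rw [lintegral_const_mul' _ _ ENNReal.ofReal_ne_top, ← withDensity_apply _ hEm,
      ← withDensity_apply _ hEm, ← hc2]
    exact hE E hEm
  refine ⟨C, ?_⟩
  filter_upwards [hae, hγ0, hpos] with lam h1 h2 h3
  rw [← ENNReal.ofReal_mul hC, ENNReal.ofReal_le_ofReal_iff (mul_nonneg hC (hk₂ lam))] at h1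
  have h4 : 0 < ‖γ lam‖ ^ 2 := by positivity
  have h5 : C * k₂ lam = C * ‖γ lam‖ ^ 2 / w lam := by simp only [k₂]; ring
  replace h3 : 0 < w lam := h3
  change w lam ≤ C
  rw [h5, le_div_iff₀ h3] at h1
  simp only [k₁] at h1
  exact le_of_mul_le_mul_left (by linarith) h4

/-! ### Stationary processes and spectral integrals -/

section Graph

variable {E F : Type*} [NormedAddCommGroup E] [InnerProductSpace ℂ E]
  [NormedAddCommGroup F] [InnerProductSpace ℂ F]

/-- The relation says that `p` is in the kernel of a continuous linear functional, so it extends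
from generators to their closed span. Applying this to one argument at a time gives
`inner_eq_of_mem_closure_span`. -/
theorem inner_snd_eq_of_mem_closure_span {S : Set (E × F)} {e : E} {y : F} {c : ℂ}
    (h : ∀ p ∈ S, inner ℂ y p.2 = c * inner ℂ e p.1) {p : E × F}
    (hp : p ∈ (Submodule.span ℂ S).topologicalClosure) :
    inner ℂ y p.2 = c * inner ℂ e p.1 := by
  let L : E × F →L[ℂ] ℂ := (innerSL ℂ y).comp (ContinuousLinearMap.snd ℂ E F) -
    c • (innerSL ℂ e).comp (ContinuousLinearMap.fst ℂ E F)
  have hL : ∀ q, L q = inner ℂ y q.2 - c * inner ℂ e q.1 := fun q => rfl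
  have h1 : (Submodule.span ℂ S).topologicalClosure ≤ LinearMap.ker L.toLinearMap := by
    refine Submodule.topologicalClosure_minimal _ (Submodule.span_le.2 fun q hq => ?_)
      L.isClosed_ker
    change L q = 0
    rw [hL, h q hq, sub_self]
  have h2 : L p = 0 := h1 hp
  rw [hL] at h2
  exact sub_eq_zero.1 h2

theorem inner_eq_of_mem_closure_span {ι : Type*} {e : ι → E} {ζ : ι → F} {c : ℝ}
    (h : ∀ s t, inner ℂ (ζ s) (ζ t) = c * inner ℂ (e s) (e t)) {p q : E × F}
    (hp : p ∈ (Submodule.span ℂ (Set.range fun t => (e t, ζ t))).topologicalClosure)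
    (hq : q ∈ (Submodule.span ℂ (Set.range fun t => (e t, ζ t))).topologicalClosure) :
    inner ℂ p.2 q.2 = c * inner ℂ p.1 q.1 := by
  refine inner_snd_eq_of_mem_closure_span ?_ hq
  rintro _ ⟨s, rfl⟩
  have h1 : inner ℂ (ζ s) p.2 = c * inner ℂ (e s) p.1 := by
    refine inner_snd_eq_of_mem_closure_span ?_ hp
    rintro _ ⟨t, rfl⟩
    exact h s t
  simp only
  rw [← inner_conj_symm, h1, map_mul, conj_ofReal, inner_conj_symm]

/-- On the closed graph `‖y‖² = c ‖x‖²`. With `c ≤ 1` and the maximum norm on the product, the first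
projection preserves norms, so its range is closed. That range contains the generators `e t`, `t ∈
U`, hence their closed span. -/
theorem exists_mem_closure_span_of_isometry [CompleteSpace E] [CompleteSpace F]
    {ι : Type*} {e : ι → E} {ζ : ι → F} {c : ℝ} (hc : c ≤ 1)
    (h : ∀ s t, inner ℂ (ζ s) (ζ t) = c * inner ℂ (e s) (e t)) (U : Set ι) {x : E}
    (hx : x ∈ (Submodule.span ℂ (e '' U)).topologicalClosure) :
    ∃ y ∈ (Submodule.span ℂ (ζ '' U)).topologicalClosure,
      (x, y) ∈ (Submodule.span ℂ ((fun t => (e t, ζ t)) '' U)).topologicalClosure := by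
  set G := (Submodule.span ℂ ((fun t => (e t, ζ t)) '' U)).topologicalClosure with hGdef
  have hGle : G ≤ (Submodule.span ℂ (Set.range fun t => (e t, ζ t))).topologicalClosure :=
    Submodule.topologicalClosure_mono (Submodule.span_mono (Set.image_subset_range _ _))
  have hGc : IsClosed (G : Set (E × F)) := Submodule.isClosed_topologicalClosure _
  have : CompleteSpace G := hGc.completeSpace_coe
  let π : G →L[ℂ] E := (ContinuousLinearMap.fst ℂ E F).comp G.subtypeL
  have hanti : AntilipschitzWith 1 π := by
    refine AddMonoidHomClass.antilipschitz_of_bound π fun p => ?_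
    have h1 := inner_eq_of_mem_closure_span h (hGle p.2) (hGle p.2)
    rw [inner_self_eq_ofReal, inner_self_eq_ofReal] at h1
    have h2 : ‖(p : E × F).2‖ ^ 2 = c * ‖(p : E × F).1‖ ^ 2 := by exact_mod_cast h1
    have h3 : ‖(p : E × F).2‖ ≤ ‖(p : E × F).1‖ := by
      refine le_of_sq_le_sq ?_ (norm_nonneg _)
      rw [h2]
      exact mul_le_of_le_one_left (by positivity) hc
    simp only [NNReal.coe_one, one_mul]
    exact max_le le_rfl h3
  have hcl : IsClosed (Set.range π) := hanti.isClosed_range π.uniformContinuous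
  have hsub : (Submodule.span ℂ (e '' U)).topologicalClosure ≤ LinearMap.range π.toLinearMap := by
    refine Submodule.topologicalClosure_minimal _ (Submodule.span_le.2 ?_) ?_
    · rintro _ ⟨t, ht, rfl⟩
      exact ⟨⟨(e t, ζ t), Submodule.le_topologicalClosure _
        (Submodule.subset_span ⟨t, ht, rfl⟩)⟩, rfl⟩
    · exact hcl
  obtain ⟨p, rfl⟩ := hsub hx
  refine ⟨(p : E × F).2, ?_, p.2⟩
  have h4 : G ≤ (Submodule.span ℂ (ζ '' U)).topologicalClosure.comap
      (ContinuousLinearMap.snd ℂ E F).toLinearMap := by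
    refine Submodule.topologicalClosure_minimal _ (Submodule.span_le.2 ?_) ?_
    · rintro _ ⟨t, ht, rfl⟩
      exact Submodule.le_topologicalClosure _ (Submodule.subset_span ⟨t, ht, rfl⟩)
    · exact (Submodule.isClosed_topologicalClosure _).preimage
        (ContinuousLinearMap.snd ℂ E F).continuous
  exact h4 p.2

end Graph

/-! ### Covariances of the processes and of the functional -/

section Stationary

variable {Ω : Type*} [MeasurableSpace Ω] {P : Measure Ω}

theorem inner_Lp_eq (X Y : Lp ℂ 2 P) :
    inner ℂ X Y = ∫ ω, Y ω * (starRingEnd ℂ) (X ω) ∂P := by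
  rw [L2.inner_def]
  simp only [RCLike.inner_apply]

theorem mse_eq_norm_sq (X Y : Lp ℂ 2 P) : mse X Y = ‖X - Y‖ ^ 2 := by
  have h : ((mse X Y : ℝ) : ℂ) = ((‖X - Y‖ ^ 2 : ℝ) : ℂ) := by
    rw [← inner_self_eq_ofReal, inner_Lp_eq, mse, ← integral_complex_ofReal]
    refine integral_congr_ae ?_
    filter_upwards [Lp.coeFn_sub X Y] with ω hω
    rw [hω, Pi.sub_apply, mul_conj, normSq_eq_norm_sq]
  exact ofReal_inj.1 h

variable {ξ η : ℝ → Lp ℂ 2 P} {f g : ℝ → ℝ}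

theorem IsStationary.inner_eq (hξ : IsStationary ξ f) (s t : ℝ) :
    inner ℂ (ξ s) (ξ t) =
      (1 / (2 * Real.pi) : ℂ) * ∫ lam : ℝ, exp (I * (t - s) * lam) * f lam := by
  rw [inner_Lp_eq, hξ.covariance t s]

theorem norm_exp_I_mul_sub (s t lam : ℝ) : ‖exp (I * (t - s) * lam)‖ = 1 := by
  have : I * (t - s) * lam = (((t - s) * lam : ℝ) : ℂ) * I := by push_cast; ring
  rw [this, norm_exp_ofReal_mul_I]

theorem IsSpectralDensity.integrable_exp_mul (hf : IsSpectralDensity f) (s t : ℝ) :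
    Integrable fun lam : ℝ => exp (I * (t - s) * lam) * f lam := by
  refine hf.integrable.ofReal.bdd_mul (c := 1) (by fun_prop)
    (Filter.Eventually.of_forall fun lam => (norm_exp_I_mul_sub s t lam).le)

theorem IsSpectralDensity.add (hf : IsSpectralDensity f) (hg : IsSpectralDensity g) :
    IsSpectralDensity (f + g) :=
  ⟨fun lam => add_nonneg (hf.nonneg lam) (hg.nonneg lam), hf.integrable.add hg.integrable⟩

theorem Uncorrelated.inner_right (h : Uncorrelated ξ η) (s t : ℝ) :
    inner ℂ (η s) (ξ t) = 0 := by
  rw [inner_Lp_eq, h t s]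

theorem Uncorrelated.inner_left (h : Uncorrelated ξ η) (s t : ℝ) :
    inner ℂ (ξ s) (η t) = 0 := by
  rw [← inner_conj_symm, h.inner_right, map_zero]

theorem inner_add_process (hξ : IsStationary ξ f) (hη : IsStationary η g)
    (h : Uncorrelated ξ η) (s t : ℝ) :
    inner ℂ ((ξ + η) s) ((ξ + η) t) =
      ((1 / (2 * Real.pi) : ℝ) : ℂ) * inner ℂ (harmonic (hξ.density.add hη.density) s)
        (harmonic (hξ.density.add hη.density) t) := by
  rw [inner_harmonic_harmonic, Pi.add_apply, Pi.add_apply, inner_add_left, inner_add_right,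
    inner_add_right, h.inner_left, h.inner_right, hξ.inner_eq, hη.inner_eq, add_zero, zero_add,
    ← mul_add, ← integral_add (hξ.density.integrable_exp_mul s t)
      (hη.density.integrable_exp_mul s t)]
  simp only [Pi.add_apply, ofReal_add, mul_add]
  push_cast
  rfl

/-- The covariance is jointly continuous by dominated convergence, and `‖ξ t - ξ s‖²` is a
combination of covariances. Continuity supplies the measurability needed for the Bochner integral
`functional`. -/
theorem IsStationary.continuous (hξ : IsStationary ξ f) : Continuous ξ := by
  have hr : Continuous fun p : ℝ × ℝ => inner ℂ (ξ p.1) (ξ p.2) := by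
    simp only [hξ.inner_eq]
    refine continuous_const.mul (continuous_of_dominated (bound := fun lam => ‖f lam‖) ?_ ?_
      hξ.density.integrable.norm ?_)
    · exact fun p => (hξ.density.integrable_exp_mul p.1 p.2).1
    · refine fun p => Filter.Eventually.of_forall fun lam => ?_
      rw [norm_mul, norm_exp_I_mul_sub, one_mul, norm_real]
    · exact Filter.Eventually.of_forall fun lam => by fun_prop
  refine continuous_iff_continuousAt.2 fun s => ?_
  rw [ContinuousAt, tendsto_iff_norm_sub_tendsto_zero]
  have h1 : ∀ t, ‖ξ t - ξ s‖ = Real.sqrt (inner ℂ (ξ t) (ξ t) - inner ℂ (ξ t) (ξ s) -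
      inner ℂ (ξ s) (ξ t) + inner ℂ (ξ s) (ξ s)).re := by
    intro t
    rw [← inner_sub_sub_self, inner_self_eq_ofReal, ofReal_re, Real.sqrt_sq (norm_nonneg _)]
  have h2 : Continuous fun t => ‖ξ t - ξ s‖ := by
    simp only [h1]
    have e1 : Continuous fun t => inner ℂ (ξ t) (ξ t) :=
      hr.comp (by fun_prop : Continuous fun t : ℝ => (t, t))
    have e2 : Continuous fun t => inner ℂ (ξ t) (ξ s) :=
      hr.comp (by fun_prop : Continuous fun t : ℝ => (t, s))
    have e3 : Continuous fun t => inner ℂ (ξ s) (ξ t) :=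
      hr.comp (by fun_prop : Continuous fun t : ℝ => (s, t))
    exact (continuous_re.comp (((e1.sub e2).sub e3).add continuous_const)).sqrt
  simpa using h2.tendsto s

theorem IsStationary.norm_eq (hξ : IsStationary ξ f) (t : ℝ) : ‖ξ t‖ = ‖ξ 0‖ := by
  have h : inner ℂ (ξ t) (ξ t) = inner ℂ (ξ 0) (ξ 0) := by
    rw [hξ.inner_eq, hξ.inner_eq, sub_self, sub_self]
  rw [inner_self_eq_ofReal, inner_self_eq_ofReal] at h
  have h2 : ‖ξ t‖ ^ 2 = ‖ξ 0‖ ^ 2 := ofReal_inj.1 h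
  exact (sq_eq_sq₀ (norm_nonneg _) (norm_nonneg _)).1 h2

variable {a : ℝ → ℂ} {D : Set ℝ}

theorem IsStationary.integrable_functional (hξ : IsStationary ξ f)
    (ha : Integrable a (volume.restrict D)) :
    Integrable (fun t => a t • ξ (-t)) (volume.restrict D) := by
  refine Integrable.mono' (ha.norm.mul_const ‖ξ 0‖) ?_ (Filter.Eventually.of_forall fun t => ?_)
  · exact ha.1.smul (hξ.continuous.comp continuous_neg).aestronglyMeasurable
  · rw [norm_smul, hξ.norm_eq]

theorem inner_functional (hξ : IsStationary ξ f) (ha : Integrable a (volume.restrict D))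
    (Z : Lp ℂ 2 P) :
    inner ℂ Z (functional a D ξ) = ∫ t in D, a t * inner ℂ Z (ξ (-t)) := by
  rw [functional, ← integral_inner (hξ.integrable_functional ha)]
  simp only [inner_smul_right]

theorem integral_mul_integral_exp (ha : Integrable a (volume.restrict D)) {F : ℝ → ℂ}
    (hF : Integrable F) :
    ∫ s in D, a s * (∫ lam : ℝ, exp (-(I * s * lam)) * F lam) =
      ∫ lam, transferFn a D lam * F lam := by
  simp only [transferFn, ← integral_const_mul, ← integral_mul_const]
  rw [integral_integral_swap]
  · refine integral_congr_ae (Filter.Eventually.of_forall fun lam => ?_)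
    simp only [mul_assoc]
  · refine (ha.mul_prod hF).mono ?_ (Filter.Eventually.of_forall fun p => ?_)
    · have h1 : Continuous fun p : ℝ × ℝ => exp (-(I * p.1 * p.2)) := by fun_prop
      exact ha.1.comp_fst.mul (h1.aestronglyMeasurable.mul hF.1.comp_snd)
    · simp [Function.uncurry, norm_exp_neg_I_mul]

theorem norm_transferFn_le (a : ℝ → ℂ) (D : Set ℝ) (lam : ℝ) :
    ‖transferFn a D lam‖ ≤ ∫ t in D, ‖a t‖ := by
  refine (norm_integral_le_integral_norm _).trans_eq ?_
  simp only [norm_mul, norm_exp_neg_I_mul, mul_one]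

theorem continuous_transferFn (ha : Integrable a (volume.restrict D)) :
    Continuous (transferFn a D) := by
  refine continuous_of_dominated (bound := fun t => ‖a t‖) ?_ ?_ ha.norm ?_
  · exact fun lam => ha.1.mul (by fun_prop)
  · refine fun lam => Filter.Eventually.of_forall fun t => ?_
    rw [norm_mul, norm_exp_neg_I_mul, mul_one]
  · exact Filter.Eventually.of_forall fun t => by fun_prop

theorem IsSpectralDensity.integrable_bdd_mul (hf : IsSpectralDensity f) {B : ℝ → ℂ}
    (hB : Continuous B) {M : ℝ} (hM : ∀ lam, ‖B lam‖ ≤ M) :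
    Integrable fun lam => B lam * f lam :=
  hf.integrable.ofReal.bdd_mul hB.aestronglyMeasurable (Filter.Eventually.of_forall hM)

/-- The covariance of `ξ(-s)` with `ξ(t)` has kernel `e^{-isλ} e^{-itλ} f(λ)`; Fubini collects the
factors `a(s) e^{-isλ}` into the transfer function. -/
theorem inner_process_functional (hξ : IsStationary ξ f) (ha : Integrable a (volume.restrict D))
    (t : ℝ) :
    inner ℂ (ξ t) (functional a D ξ) = (1 / (2 * Real.pi) : ℂ) *
      ∫ lam : ℝ, transferFn a D lam * (exp (-(I * t * lam)) * f lam) := by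
  rw [inner_functional hξ ha, ← integral_mul_integral_exp ha
    (hξ.density.integrable_bdd_mul (by fun_prop) fun lam => (norm_exp_neg_I_mul t lam).le),
    ← integral_const_mul]
  refine integral_congr_ae (Filter.Eventually.of_forall fun s => ?_)
  simp only
  rw [hξ.inner_eq, mul_left_comm]
  congr 3
  ext lam
  rw [← mul_assoc, ← exp_add]
  congr 2
  push_cast
  ring

theorem norm_sq_functional (hξ : IsStationary ξ f) (ha : Integrable a (volume.restrict D)) :
    ((‖functional a D ξ‖ ^ 2 : ℝ) : ℂ) = (1 / (2 * Real.pi) : ℂ) *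
      ∫ lam : ℝ, transferFn a D lam * ((starRingEnd ℂ) (transferFn a D lam) * f lam) := by
  rw [← inner_self_eq_ofReal, inner_functional hξ ha, ← integral_mul_integral_exp ha
    (hξ.density.integrable_bdd_mul (B := fun lam => (starRingEnd ℂ) (transferFn a D lam))
      (continuous_conj.comp (continuous_transferFn ha))
      fun lam => by simpa using norm_transferFn_le a D lam), ← integral_const_mul]
  refine integral_congr_ae (Filter.Eventually.of_forall fun s => ?_)
  simp only
  rw [← inner_conj_symm, inner_process_functional hξ ha, mul_left_comm, map_mul, ← integral_conj]
  congr 2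
  · simp [Complex.conj_ofNat]
  · congr 1
    ext lam
    simp only [map_mul, ← exp_conj, conj_ofReal, map_neg, conj_I]
    rw [mul_left_comm]
    congr 2
    push_cast
    ring

theorem inner_noise_functional (hξ : IsStationary ξ f) (h : Uncorrelated ξ η)
    (ha : Integrable a (volume.restrict D)) (t : ℝ) :
    inner ℂ (η t) (functional a D ξ) = 0 := by
  rw [inner_functional hξ ha]
  simp [h.inner_right]

end Stationary

/-! ### The observation set -/

theorem isClosed_gaps (s : ℕ) (Nl Kl : ℕ → ℝ) : IsClosed (gaps s Nl Kl) :=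
  (Finset.finite_toSet _).isClosed_biUnion fun _ _ => isClosed_Icc

theorem measurableSet_unobsSet (s : ℕ) (Nl Kl : ℕ → ℝ) : MeasurableSet (unobsSet s Nl Kl) :=
  (isClosed_gaps s Nl Kl).measurableSet.union measurableSet_Ici

theorem isOpen_obsSet (s : ℕ) (Nl Kl : ℕ → ℝ) : IsOpen (obsSet s Nl Kl) :=
  isOpen_Iio.sdiff (isClosed_gaps s Nl Kl)

theorem mem_obsSet_iff (s : ℕ) (Nl Kl : ℕ → ℝ) (t : ℝ) :
    t ∈ obsSet s Nl Kl ↔ t ∉ unobsSet s Nl Kl := by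
  simp only [obsSet, unobsSet, Set.mem_sdiff, Set.mem_Iio, Set.mem_union, Set.mem_Ici, not_or,
    not_le, and_comm]

/-! ### Orthogonality in the frequency domain -/

/-- If `c ∈ L₂(T)` has an integrable transform, then its continuous representative vanishes on
open sets that do not meet `T`. -/
theorem integral_hat_mul_exp_eq_zero {T U : Set ℝ} (c : L2On T)
    (hc : Integrable (hat plusTransform c)) (hU : IsOpen U) (hUT : ∀ t ∈ U, t ∉ T) {t : ℝ}
    (ht : t ∈ U) : ∫ lam : ℝ, hat plusTransform c lam * exp (-(I * t * lam)) = 0 := by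
  set G : ℝ → ℂ := fun t => ∫ lam : ℝ, hat plusTransform c lam * exp (-(I * t * lam))
  have hG : Continuous G := by
    refine continuous_of_dominated (bound := fun lam => ‖hat plusTransform c lam‖) ?_ ?_
      hc.norm ?_
    · exact fun t => hc.1.mul (by fun_prop)
    · refine fun t => Filter.Eventually.of_forall fun lam => ?_
      rw [norm_mul, norm_exp_neg_I_mul, mul_one]
    · exact Filter.Eventually.of_forall fun lam => by fun_prop
  have hae : G =ᵐ[volume.restrict U] fun _ => 0 := by
    rw [Filter.EventuallyEq, ae_restrict_iff' hU.measurableSet]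
    filter_upwards [c.2, ae_eq_inversion hc] with t h1 h2 h3
    rw [h1 (hUT t h3)] at h2
    have hpi : (1 / (2 * Real.pi) : ℂ) ≠ 0 := by
      have : (Real.pi : ℂ) ≠ 0 := by exact_mod_cast Real.pi_ne_zero
      exact one_div_ne_zero (mul_ne_zero two_ne_zero this)
    exact (mul_eq_zero.1 h2.symm).resolve_left hpi
  -- Vanishing at every point of `U`, not only almost everywhere, is needed because each single
  -- observation enters the span.
  exact Measure.eqOn_open_of_ae_eq hae hU hG.continuousOn continuousOn_const ht

/-- This is where boundedness of the density enters: `|w φ|² ≤ M w |φ|²`. -/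
theorem memLp_ofReal_mul_of_le {w : ℝ → ℝ} (hw : IsSpectralDensity w) {M : ℝ}
    (hM : ∀ᵐ lam, w lam ≤ M) (φ : Lp ℂ 2 (weighted w)) :
    MemLp (fun lam => (w lam : ℂ) * φ lam) 2 volume := by
  have h1 := (integrable_weighted_mul hw φ).1
  rw [memLp_two_iff_integrable_sq_norm h1]
  refine (((memLp_weighted_iff hw (Lp.memLp φ).1).1 (Lp.memLp φ)).const_mul M).mono'
    (h1.norm.pow 2) ?_
  filter_upwards [hM] with lam hl
  rw [Real.norm_of_nonneg (by positivity), norm_mul, norm_real, Real.norm_of_nonneg (hw.nonneg lam),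
    mul_pow, sq (w lam), mul_assoc]
  exact mul_le_mul_of_nonneg_right hl (mul_nonneg (hw.nonneg lam) (by positivity))

/-- By double orthogonality it suffices to test `h` against each `ψ` orthogonal to the span. The
inverse transform of `w ψ` at `t` is a multiple of `⟨e^{itλ}, ψ⟩`, which vanishes for `t ∉ T`. So `w
ψ = x̂` with `x ∈ L₂(T)`, and `|x̂|² / w = w |ψ|²` puts `x` in the form domain. -/
theorem mem_harmonicSpan_of_forall {w : ℝ → ℝ} (hw : IsSpectralDensity w)
    (hpos : ∀ᵐ lam, 0 < w lam) {M : ℝ} (hM : ∀ᵐ lam, w lam ≤ M) {T U : Set ℝ}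
    (hTU : ∀ t, t ∉ T → t ∈ U) (h : Lp ℂ 2 (weighted w))
    (H : ∀ x ∈ formDomain T (fun lam => 1 / w lam) plusTransform,
      ∫ lam, h lam * (starRingEnd ℂ) (hat plusTransform x lam) = 0) :
    h ∈ harmonicSpan w U := by
  have hcl : IsClosed (harmonicSpan w U : Set (Lp ℂ 2 (weighted w))) :=
    Submodule.isClosed_topologicalClosure _
  have : CompleteSpace (harmonicSpan w U) := hcl.completeSpace_coe
  rw [← Submodule.orthogonal_orthogonal (harmonicSpan w U)]
  refine (Submodule.mem_orthogonal _ _).2 fun ψ hψ => ?_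
  obtain ⟨x, hx⟩ := exists_hat_ae_eq plusTransform (memLp_ofReal_mul_of_le hw hM ψ)
  have hxi : Integrable (hat plusTransform x) := (integrable_weighted_mul hw ψ).congr hx.symm
  have hxT : x ∈ L2On T := by
    filter_upwards [ae_eq_inversion hxi] with t ht hn
    have h1 : inner ℂ (harmonic hw t) ψ = 0 := by
      refine (Submodule.mem_orthogonal _ _).1 hψ _ ?_
      rw [harmonicSpan_eq hw]
      exact Submodule.le_topologicalClosure _ (Submodule.subset_span ⟨t, hTU t hn, rfl⟩)
    rw [inner_harmonic_left] at h1
    rw [ht, integral_congr_ae (hx.mono fun lam hl => by rw [hl]), h1, mul_zero]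
  have hxm : (⟨x, hxT⟩ : L2On T) ∈ formDomain T (fun lam => 1 / w lam) plusTransform := by
    refine (memLp_weightedHat_iff (fun lam => div_nonneg zero_le_one (hw.nonneg lam))
      (hw.integrable.aemeasurable.const_div 1) _ _).2 ?_
    refine ((memLp_weighted_iff hw (Lp.memLp ψ).1).1 (Lp.memLp ψ)).congr ?_
    filter_upwards [hx, hpos] with lam h1 h2
    rw [h1, norm_mul, norm_real, Real.norm_of_nonneg h2.le]
    field_simp
  rw [inner_weighted hw, ← H _ hxm]
  refine integral_congr_ae ?_
  filter_upwards [hx] with lam h1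
  simp only [h1, map_mul, conj_ofReal]
  ring

/-! ### The optimal spectral characteristic -/

/-- Here `(f + g)(A - h) = g A + c` and `(f + g) h = f A - c`; with weights `f` and `g` the mixed
terms in `A` and `c` cancel. -/
theorem norm_sq_add_norm_sq_eq {A c h : ℂ} {f g : ℝ} (hw : 0 < f + g)
    (hh : h = A * (f / (f + g) : ℝ) - c / (f + g : ℝ)) :
    ‖A - h‖ ^ 2 * f + ‖h‖ ^ 2 * g = f * g / (f + g) * ‖A‖ ^ 2 + 1 / (f + g) * ‖c‖ ^ 2 := by
  have hre : h.re = A.re * (f / (f + g)) - c.re / (f + g) := by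
    rw [hh, sub_re, re_mul_ofReal, div_ofReal_re]
  have him : h.im = A.im * (f / (f + g)) - c.im / (f + g) := by
    rw [hh, sub_im, im_mul_ofReal, div_ofReal_im]
  simp only [Complex.sq_norm, normSq_apply, sub_re, sub_im, hre, him]
  field_simp
  ring

/-- The integrand of `‖X‖² - ‖Y‖²`, corrected by a term whose integral vanishes because `c / (f +
g)` is orthogonal to `h` in `L₂(f + g)`. -/
theorem norm_sq_sub_eq {A c h : ℂ} {f g : ℝ} (hw : 0 < f + g)
    (hh : h = A * (f / (f + g) : ℝ) - c / (f + g : ℝ)) :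
    ‖A‖ ^ 2 * f - (f + g) * ‖h‖ ^ 2 - 2 * (c * (starRingEnd ℂ) h).re =
      f * g / (f + g) * ‖A‖ ^ 2 + 1 / (f + g) * ‖c‖ ^ 2 := by
  have hre : h.re = A.re * (f / (f + g)) - c.re / (f + g) := by
    rw [hh, sub_re, re_mul_ofReal, div_ofReal_re]
  have him : h.im = A.im * (f / (f + g)) - c.im / (f + g) := by
    rw [hh, sub_im, im_mul_ofReal, div_ofReal_im]
  simp only [Complex.sq_norm, normSq_apply, mul_re, conj_re, conj_im, hre, him]
  field_simp
  ring

section Characteristic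

variable {f g : ℝ → ℝ} {A : ℝ → ℂ} {M : ℝ} {T : Set ℝ} {c : L2On T}

theorem integrable_mul_norm_sq (hf : IsSpectralDensity f) (hA : Continuous A)
    (hM : ∀ lam, ‖A lam‖ ≤ M) : Integrable fun lam => ‖A lam‖ ^ 2 * f lam := by
  refine hf.integrable.bdd_mul (c := M ^ 2) (by fun_prop) (Filter.Eventually.of_forall fun lam => ?_)
  rw [Real.norm_of_nonneg (by positivity)]
  exact pow_le_pow_left₀ (norm_nonneg _) (hM lam) 2

theorem mul_div_add_le_left {a b : ℝ} (ha : 0 ≤ a) (hb : 0 ≤ b) : a * b / (a + b) ≤ a := by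
  rcases (add_nonneg ha hb).eq_or_lt with h | h
  · rw [← h, div_zero]; exact ha
  · rw [div_le_iff₀ h]; nlinarith [mul_nonneg ha ha]

theorem integrable_mul_div_mul_norm_sq (hf : IsSpectralDensity f) (hg : IsSpectralDensity g)
    (hA : Continuous A) (hM : ∀ lam, ‖A lam‖ ≤ M) :
    Integrable fun lam => f lam * g lam / (f lam + g lam) * ‖A lam‖ ^ 2 := by
  refine (integrable_mul_norm_sq hf hA hM).mono' ?_ (Filter.Eventually.of_forall fun lam => ?_)
  · have h1 := hf.integrable.aemeasurable
    have h2 := hg.integrable.aemeasurable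
    exact ((h1.mul h2).div (h1.add h2)).aestronglyMeasurable.mul (by fun_prop)
  · have h1 := hf.nonneg lam
    have h2 := hg.nonneg lam
    rw [Real.norm_of_nonneg (by positivity), mul_comm]
    exact mul_le_mul_of_nonneg_left (mul_div_add_le_left h1 h2) (by positivity)

theorem memLp_hat_div (hw : IsSpectralDensity (f + g)) (hpos : ∀ᵐ lam, 0 < f lam + g lam)
    (hc : Integrable fun lam => 1 / (f lam + g lam) * ‖hat plusTransform c lam‖ ^ 2) :
    MemLp (fun lam => hat plusTransform c lam / (f lam + g lam : ℝ)) 2 (weighted (f + g)) := by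
  have hm : AEStronglyMeasurable (fun lam => hat plusTransform c lam / (f lam + g lam : ℝ)) volume :=
    ((memLp_hat _ _).1.aemeasurable.div
      (Complex.measurable_ofReal.comp_aemeasurable hw.integrable.aemeasurable)).aestronglyMeasurable
  refine (memLp_weighted_iff hw (hm.mono_ac weighted_absolutelyContinuous)).2 (hc.congr ?_)
  filter_upwards [hpos] with lam hl
  rw [norm_div, norm_real, Real.norm_of_nonneg hl.le, Pi.add_apply]
  field_simp

theorem memLp_mul_div (hf : IsSpectralDensity f) (hg : IsSpectralDensity g)
    (hA : Continuous A) (hM : ∀ lam, ‖A lam‖ ≤ M) :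
    MemLp (fun lam => A lam * (f lam / (f lam + g lam) : ℝ)) 2 (weighted (f + g)) := by
  have := (hf.add hg).isFiniteMeasure
  have hm : AEStronglyMeasurable (fun lam => A lam * (f lam / (f lam + g lam) : ℝ)) volume :=
    hA.aestronglyMeasurable.mul (Complex.measurable_ofReal.comp_aemeasurable
      (hf.integrable.aemeasurable.div (hf.add hg).integrable.aemeasurable)).aestronglyMeasurable
  refine MemLp.of_bound (hm.mono_ac weighted_absolutelyContinuous) M
    (Filter.Eventually.of_forall fun lam => ?_)
  have h1 := hf.nonneg lam
  have h2 := hg.nonneg lam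
  rw [norm_mul, norm_real, Real.norm_of_nonneg (by positivity)]
  exact (mul_le_of_le_one_right (norm_nonneg _)
    (div_le_one_of_le₀ (by linarith) (by linarith))).trans (hM lam)

theorem memLp_optimalCharacteristic (hf : IsSpectralDensity f) (hg : IsSpectralDensity g)
    (hpos : ∀ᵐ lam, 0 < f lam + g lam) (hA : Continuous A) (hM : ∀ lam, ‖A lam‖ ≤ M)
    (hc : Integrable fun lam => 1 / (f lam + g lam) * ‖hat plusTransform c lam‖ ^ 2) :
    MemLp (optimalCharacteristic A f g c) 2 (weighted (f + g)) :=
  (memLp_mul_div hf hg hA hM).sub (memLp_hat_div (hf.add hg) hpos hc)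

/-- `ĉ = w · (ĉ / w)` with `ĉ / w ∈ L₂(w) ⊆ L₁(w)`. -/
theorem integrable_hat (hw : IsSpectralDensity (f + g)) (hpos : ∀ᵐ lam, 0 < f lam + g lam)
    (hc : Integrable fun lam => 1 / (f lam + g lam) * ‖hat plusTransform c lam‖ ^ 2) :
    Integrable (hat plusTransform c) := by
  refine (integrable_weighted_mul hw ((memLp_hat_div hw hpos hc).toLp _)).congr ?_
  filter_upwards [hpos, (hw.absolutelyContinuous hpos).ae_le
    (memLp_hat_div hw hpos hc).coeFn_toLp] with lam h1 h2
  rw [h2, Pi.add_apply, mul_div_cancel₀]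
  exact_mod_cast h1.ne'

theorem spectralError_eq (hf : IsSpectralDensity f) (hg : IsSpectralDensity g)
    (hpos : ∀ᵐ lam, 0 < f lam + g lam) (hA : Continuous A) (hM : ∀ lam, ‖A lam‖ ≤ M)
    (hc : Integrable fun lam => 1 / (f lam + g lam) * ‖hat plusTransform c lam‖ ^ 2) :
    spectralError A (optimalCharacteristic A f g c) f g = 1 / (2 * Real.pi) *
      ∫ lam, (f lam * g lam / (f lam + g lam) * ‖A lam‖ ^ 2 +
        1 / (f lam + g lam) * ‖hat plusTransform c lam‖ ^ 2) := by
  set h := optimalCharacteristic A f g c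
  have hE := (integrable_mul_div_mul_norm_sq hf hg hA hM).add hc
  have hid : ∀ᵐ lam, ‖A lam - h lam‖ ^ 2 * f lam + ‖h lam‖ ^ 2 * g lam =
      f lam * g lam / (f lam + g lam) * ‖A lam‖ ^ 2 +
        1 / (f lam + g lam) * ‖hat plusTransform c lam‖ ^ 2 :=
    hpos.mono fun lam hl => norm_sq_add_norm_sq_eq hl rfl
  have hhm : AEStronglyMeasurable h volume :=
    (memLp_optimalCharacteristic hf hg hpos hA hM hc).1.mono_ac
      ((hf.add hg).absolutelyContinuous hpos)
  -- Each of the two nonnegative summands is dominated by their sum, which the pointwise identity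
  -- shows to be integrable.
  have i1 : Integrable fun lam => ‖A lam - h lam‖ ^ 2 * f lam := by
    refine hE.mono' (((hA.aestronglyMeasurable.sub hhm).norm.pow 2).mul hf.integrable.1) ?_
    filter_upwards [hid] with lam hl
    have h1 := hf.nonneg lam
    have h2 := mul_nonneg (sq_nonneg ‖h lam‖) (hg.nonneg lam)
    rw [Real.norm_of_nonneg (by positivity), Pi.add_apply, ← hl]
    linarith
  have i2 : Integrable fun lam => ‖h lam‖ ^ 2 * g lam := by
    refine hE.mono' ((hhm.norm.pow 2).mul hg.integrable.1) ?_
    filter_upwards [hid] with lam hl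
    have h1 := hg.nonneg lam
    have h2 := mul_nonneg (sq_nonneg ‖A lam - h lam‖) (hf.nonneg lam)
    rw [Real.norm_of_nonneg (by positivity), Pi.add_apply, ← hl]
    linarith
  rw [spectralError, ← mul_add, ← integral_add i1 i2, integral_congr_ae hid]

end Characteristic

/-! ### Optimal estimates -/

section Estimate

variable {Ω : Type*} [MeasurableSpace Ω] {P : Measure Ω} {ζ : ℝ → Lp ℂ 2 P} {U : Set ℝ}
  {X Y : Lp ℂ 2 P}

theorem inner_eq_zero_of_mem_closedSpan {Z W : Lp ℂ 2 P} (h : ∀ t ∈ U, inner ℂ (ζ t) W = 0)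
    (hZ : Z ∈ closedSpan ζ U) : inner ℂ Z W = 0 := by
  have h1 : closedSpan ζ U ≤ LinearMap.ker (innerSL ℂ W).toLinearMap := by
    refine Submodule.topologicalClosure_minimal _ (Submodule.span_le.2 ?_)
      (innerSL ℂ W).isClosed_ker
    rintro _ ⟨t, ht, rfl⟩
    change inner ℂ W (ζ t) = 0
    rw [← inner_conj_symm, h t ht, map_zero]
  have h2 : inner ℂ W Z = 0 := h1 hZ
  rw [← inner_conj_symm, h2, map_zero]

theorem mse_eq_add_of_orthogonal (hY : Y ∈ closedSpan ζ U) (h : ∀ t ∈ U, inner ℂ (ζ t) (X - Y) = 0)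
    {Y' : Lp ℂ 2 P} (hY' : Y' ∈ closedSpan ζ U) : mse X Y' = mse X Y + ‖Y - Y'‖ ^ 2 := by
  have h1 := inner_eq_zero_of_mem_closedSpan h (Submodule.sub_mem _ hY hY')
  rw [mse_eq_norm_sq, mse_eq_norm_sq]
  have h2 := norm_add_sq_eq_norm_sq_add_norm_sq_of_inner_eq_zero (𝕜 := ℂ) (X - Y) (Y - Y')
    (by rw [← inner_conj_symm, h1, map_zero])
  rw [sub_add_sub_cancel] at h2
  linarith [h2, sq ‖X - Y'‖, sq ‖X - Y‖, sq ‖Y - Y'‖]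

theorem isOptimalEstimate_of_orthogonal (hY : Y ∈ closedSpan ζ U)
    (h : ∀ t ∈ U, inner ℂ (ζ t) (X - Y) = 0) : IsOptimalEstimate ζ U X Y := by
  refine ⟨hY, fun Y' hY' => ?_⟩
  rw [mse_eq_add_of_orthogonal hY h hY']
  linarith [sq_nonneg ‖Y - Y'‖]

theorem IsOptimalEstimate.eq_of_orthogonal (hY : Y ∈ closedSpan ζ U)
    (h : ∀ t ∈ U, inner ℂ (ζ t) (X - Y) = 0) {Y' : Lp ℂ 2 P} (hY' : IsOptimalEstimate ζ U X Y') :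
    Y' = Y := by
  have h1 := mse_eq_add_of_orthogonal hY h hY'.1
  have h2 := hY'.2 Y hY
  have h3 : ‖Y - Y'‖ = 0 := by
    have : ‖Y - Y'‖ ^ 2 ≤ 0 := by linarith
    exact pow_eq_zero_iff two_ne_zero |>.1 (le_antisymm this (sq_nonneg _))
  exact (sub_eq_zero.1 (norm_eq_zero.1 h3)).symm

theorem spectralIntegralGraph_eq {w : ℝ → ℝ} (hw : IsSpectralDensity w) :
    spectralIntegralGraph ζ w =
      (Submodule.span ℂ (Set.range fun t => (harmonic hw t, ζ t))).topologicalClosure := by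
  rw [spectralIntegralGraph]
  congr 2
  ext p
  simp only [isHarmonic_iff hw, Set.mem_ofPred_eq, Set.mem_range]
  exact ⟨fun ⟨t, h1, h2⟩ => ⟨t, Prod.ext h1.symm h2.symm⟩,
    fun ⟨t, h⟩ => ⟨t, h ▸ rfl, h ▸ rfl⟩⟩

/-- On the graph `‖Y‖² = κ ‖h‖²` with `κ > 0`, so `Y` determines the class of `h` in `L₂(w)`;
positivity of `w` makes this Lebesgue almost everywhere equality. -/
theorem isSpectralCharacteristic_iff {w : ℝ → ℝ} (hw : IsSpectralDensity w)
    (hpos : ∀ᵐ lam, 0 < w lam) {κ : ℝ} (hκ : 0 < κ)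
    (hζ : ∀ s t, inner ℂ (ζ s) (ζ t) = κ * inner ℂ (harmonic hw s) (harmonic hw t))
    {h : ℝ → ℂ} (hh : IsSpectralCharacteristic ζ w U h Y) (h' : ℝ → ℂ) :
    IsSpectralCharacteristic ζ w U h' Y ↔ h' =ᵐ[volume] h := by
  obtain ⟨hm, h1, h2⟩ := hh
  constructor
  · rintro ⟨hm', -, h2'⟩
    rw [spectralIntegralGraph_eq hw] at h2 h2'
    have h3 := Submodule.sub_mem _ h2' h2
    have h4 := inner_eq_of_mem_closure_span hζ h3 h3
    simp only [Prod.snd_sub, Prod.fst_sub, sub_self, inner_zero_left] at h4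
    have h5 : hm'.toLp h' = hm.toLp h := by
      have h6 := (mul_eq_zero.1 h4.symm).resolve_left (by exact_mod_cast hκ.ne')
      exact sub_eq_zero.1 (inner_self_eq_zero.1 h6)
    exact (hw.absolutelyContinuous hpos).ae_le ((MemLp.toLp_eq_toLp_iff hm' hm).1 h5)
  · intro he
    have he' := weighted_absolutelyContinuous.ae_le (μ := weighted w) he
    have hm' : MemLp h' 2 (weighted w) := (memLp_congr_ae he').2 hm
    have h5 : hm'.toLp h' = hm.toLp h := (MemLp.toLp_eq_toLp_iff hm' hm).2 he'
    exact ⟨hm', h5 ▸ h1, h5 ▸ h2⟩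

end Estimate

/-! ### Domains of `R` and `Q`, and membership of the characteristic in the span -/

theorem IsSpectralDensity.div_add_le_one {f g : ℝ → ℝ} (hf : IsSpectralDensity f)
    (hg : IsSpectralDensity g) (lam : ℝ) : f lam / (f lam + g lam) ≤ 1 :=
  div_le_one_of_le₀ (by linarith [hg.nonneg lam]) (add_nonneg (hf.nonneg lam) (hg.nonneg lam))

theorem mem_domain_opR {f g : ℝ → ℝ} (hf : IsSpectralDensity f) (hg : IsSpectralDensity g)
    {T : Set ℝ} (hT : MeasurableSet T) (x : L2On T) : x ∈ (opR T f g).domain :=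
  mem_domain_kernelOp_of_bounded hT
    (fun lam => div_nonneg (hf.nonneg lam) (add_nonneg (hf.nonneg lam) (hg.nonneg lam)))
    (hf.integrable.aemeasurable.div (hf.add hg).integrable.aemeasurable)
    (Filter.Eventually.of_forall (hf.div_add_le_one hg)) _ _ x

theorem mem_domain_opQ {f g : ℝ → ℝ} (hf : IsSpectralDensity f) (hg : IsSpectralDensity g)
    {M : ℝ} (hM : ∀ᵐ lam, f lam + g lam ≤ M)
    {T : Set ℝ} (hT : MeasurableSet T) (x : L2On T) : x ∈ (opQ T f g).domain := by
  refine mem_domain_kernelOp_of_bounded (M := M) hT (fun lam => div_nonneg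
    (mul_nonneg (hf.nonneg lam) (hg.nonneg lam)) (add_nonneg (hf.nonneg lam) (hg.nonneg lam)))
    ((hf.integrable.aemeasurable.mul hg.integrable.aemeasurable).div
      (hf.add hg).integrable.aemeasurable) ?_ _ _ x
  filter_upwards [hM] with lam hl
  linarith [mul_div_add_le_left (hf.nonneg lam) (hg.nonneg lam), hg.nonneg lam]

theorem integrable_of_memLp_truncSet {s : ℕ} {Nl Kl : ℕ → ℝ} {N : ℝ} {a : ℝ → ℂ}
    (ha : MemLp a 2 (volume.restrict (truncSet s Nl Kl N))) :
    Integrable a (volume.restrict (truncSet s Nl Kl N)) := by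
  have : IsFiniteMeasure (volume.restrict (truncSet s Nl Kl N)) := by
    refine ⟨?_⟩
    rw [Measure.restrict_apply_univ]
    exact (measure_mono Set.inter_subset_left).trans_lt measure_Icc_lt_top
  exact ha.integrable (by norm_num)

theorem hat_minus_restrictTo {T D : Set ℝ} {a : ℝ → ℂ} (hD : MeasurableSet D) (hDT : D ⊆ T)
    (ha : MemLp a 2 (volume.restrict D)) (hai : Integrable a (volume.restrict D)) :
    hat minusTransform (restrictTo hD hDT ha : L2On T) =ᵐ[volume] transferFn a D := by
  refine (hat_minus_ae_eq ((integrable_indicator_iff hD).2 hai)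
    ((memLp_indicator_iff_restrict hD).2 ha).coeFn_toLp).trans
      (Filter.Eventually.of_forall fun lam => ?_)
  simp only [transferFn]
  rw [← integral_indicator hD]
  refine integral_congr_ae (Filter.Eventually.of_forall fun u => ?_)
  by_cases h : u ∈ D <;> simp [h]

/-- The optimal spectral characteristic lies in the span of the observed harmonics. -/
theorem optimalCharacteristic_mem_harmonicSpan {f g : ℝ → ℝ} (hf : IsSpectralDensity f)
    (hg : IsSpectralDensity g) (hpos : ∀ᵐ lam, 0 < f lam + g lam) {M : ℝ}
    (hM : ∀ᵐ lam, f lam + g lam ≤ M) {T U : Set ℝ} (hTU : ∀ t, t ∉ T → t ∈ U) {A : ℝ → ℂ}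
    {x : L2On T} (hxA : hat minusTransform x =ᵐ[volume] A) (hR : x ∈ (opR T f g).domain)
    (c : (opB T f g).domain) (hc : opB T f g c = opR T f g ⟨x, hR⟩)
    (hh : MemLp (optimalCharacteristic A f g (c : L2On T)) 2 (weighted (f + g))) :
    hh.toLp _ ∈ harmonicSpan (f + g) U := by
  have hw := hf.add hg
  have h0 : ∀ lam, 0 ≤ f lam + g lam := hw.nonneg
  refine mem_harmonicSpan_of_forall hw hpos hM hTU _ fun z hz => ?_
  have hzR : z ∈ formDomain T (fun lam => f lam / (f lam + g lam)) plusTransform :=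
    memLp_weightedHat_of_bounded
      (hf.integrable.aemeasurable.div hw.integrable.aemeasurable)
      (Filter.Eventually.of_forall (hf.div_add_le_one hg)) _ _
  have h1 := inner_kernelOp (σ := fun lam => f lam / (f lam + g lam)) (U := minusTransform)
    (V := plusTransform) ⟨x, hR⟩ hzR
  have h2 := inner_kernelOp (σ := fun lam => 1 / (f lam + g lam)) (U := plusTransform)
    (V := plusTransform) c hz
  -- The equation `B c = R x` tested against `z`. The weight of `R` is at most one, so `z` is also
  -- admissible for its form. The difference of the two integrands is `h conj ẑ`.
  have h3 : kernelForm (fun lam => f lam / (f lam + g lam)) minusTransform plusTransform x z =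
      kernelForm (fun lam => 1 / (f lam + g lam)) plusTransform plusTransform (c : L2On T) z := by
    rw [← h1, ← h2]
    exact congrArg _ hc.symm
  have hpi : (1 / (2 * Real.pi) : ℂ) ≠ 0 := by
    have : (Real.pi : ℂ) ≠ 0 := by exact_mod_cast Real.pi_ne_zero
    exact one_div_ne_zero (mul_ne_zero two_ne_zero this)
  have h4 := mul_left_cancel₀ hpi h3
  have i1 := integrable_form (σ := fun lam => f lam / (f lam + g lam)) (U := minusTransform)
    (V := plusTransform) (mem_kernelGraph (⟨x, hR⟩ : (opR T f g).domain)).1 hzR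
  have i2 := integrable_form (σ := fun lam => 1 / (f lam + g lam)) (U := plusTransform)
    (V := plusTransform) (mem_kernelGraph c).1 hz
  rw [← sub_eq_zero, ← integral_sub i1 i2] at h4
  rw [← h4]
  refine integral_congr_ae ?_
  filter_upwards [(hw.absolutelyContinuous hpos).ae_le hh.coeFn_toLp, hxA] with lam e1 e2
  refine Eq.trans ?_ (congrArg₂ (· - ·)
    (weightedHat_mul_conj (σ := fun lam => f lam / (f lam + g lam))
      (div_nonneg (hf.nonneg lam) (h0 lam)) _ _ _ _).symm
    (weightedHat_mul_conj (σ := fun lam => 1 / (f lam + g lam))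
      (div_nonneg zero_le_one (h0 lam)) _ _ _ _).symm)
  rw [e1, e2, optimalCharacteristic]
  push_cast
  ring

theorem one_div_two_pi_ofReal :
    (1 / (2 * Real.pi) : ℂ) = ((1 / (2 * Real.pi) : ℝ) : ℂ) := by
  push_cast
  rfl

/-! ### Normal equations and the mean-square error -/

section Main

variable {Ω : Type*} [MeasurableSpace Ω] {P : Measure Ω} {f g : ℝ → ℝ} {ξ η : ℝ → Lp ℂ 2 P}
  {a : ℝ → ℂ} {D T U : Set ℝ} {c : L2On T}

/-- Normal equations: `A ξ - ∫ h d(Z_ξ + Z_η)` is orthogonal to the observations. -/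
theorem inner_sub_eq_zero (hξ : IsStationary ξ f) (hη : IsStationary η g)
    (hξη : Uncorrelated ξ η) (hpos : ∀ᵐ lam, 0 < f lam + g lam)
    (hai : Integrable a (volume.restrict D))
    (hc : Integrable (hat plusTransform c))
    {t : ℝ} (ht : ∫ lam : ℝ, hat plusTransform c lam * exp (-(I * t * lam)) = 0)
    (hh : MemLp (optimalCharacteristic (transferFn a D) f g c) 2 (weighted (f + g)))
    {Y : Lp ℂ 2 P} (hY : (hh.toLp _, Y) ∈ spectralIntegralGraph (ξ + η) (f + g)) :
    inner ℂ ((ξ + η) t) (functional a D ξ - Y) = 0 := by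
  have hw := hξ.density.add hη.density
  rw [spectralIntegralGraph_eq hw] at hY
  have h1 := inner_eq_of_mem_closure_span (inner_add_process hξ hη hξη)
    (Submodule.le_topologicalClosure _ (Submodule.subset_span ⟨t, rfl⟩)) hY
  simp only at h1
  rw [inner_sub_right, h1, inner_harmonic_left, Pi.add_apply, inner_add_left,
    inner_noise_functional hξ hξη hai, add_zero, inner_process_functional hξ hai,
    one_div_two_pi_ofReal, ← mul_sub, mul_eq_zero]
  right
  have i1 : Integrable fun lam : ℝ => transferFn a D lam * (exp (-(I * t * lam)) * f lam) :=
    (hξ.density.integrable_bdd_mul (by fun_prop) fun lam => (norm_exp_neg_I_mul t lam).le).bdd_mul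
      (continuous_transferFn hai).aestronglyMeasurable
      (Filter.Eventually.of_forall (norm_transferFn_le a D))
  have i2 : Integrable fun lam : ℝ => hat plusTransform c lam * exp (-(I * t * lam)) :=
    hc.mul_bdd (c := 1) (by fun_prop) (Filter.Eventually.of_forall fun lam =>
      (norm_exp_neg_I_mul t lam).le)
  -- Here `w h = A f - ĉ`, so the two covariances differ only by the integral of `ĉ e^{-itλ}`, which
  -- is zero by `ht`.
  have h2 : ∫ lam : ℝ, ((f + g) lam * (hh.toLp _ : Lp ℂ 2 (weighted (f + g))) lam) *
      exp (-(I * t * lam)) = ∫ lam : ℝ, (transferFn a D lam * (exp (-(I * t * lam)) * f lam) -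
        hat plusTransform c lam * exp (-(I * t * lam))) := by
    refine integral_congr_ae ?_
    filter_upwards [(hw.absolutelyContinuous hpos).ae_le hh.coeFn_toLp, hpos] with lam e1 e2
    have e3 : ((f lam + g lam : ℝ) : ℂ) ≠ 0 := by exact_mod_cast e2.ne'
    rw [e1, optimalCharacteristic, Pi.add_apply, ofReal_div]
    field_simp
  rw [h2, integral_sub i1 i2, ht, sub_zero, sub_self]

/-- The mean-square error in terms of `f g |A|² / (f + g) + |C|² / (f + g)`. -/
theorem norm_sub_sq_eq (hξ : IsStationary ξ f) (hη : IsStationary η g)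
    (hξη : Uncorrelated ξ η) (hpos : ∀ᵐ lam, 0 < f lam + g lam)
    (hai : Integrable a (volume.restrict D))
    (hc : Integrable fun lam => 1 / (f lam + g lam) * ‖hat plusTransform c lam‖ ^ 2)
    (ht : ∀ t ∈ U, ∫ lam : ℝ, hat plusTransform c lam * exp (-(I * t * lam)) = 0)
    (hh : MemLp (optimalCharacteristic (transferFn a D) f g c) 2 (weighted (f + g)))
    (hhU : hh.toLp _ ∈ harmonicSpan (f + g) U)
    {Y : Lp ℂ 2 P} (hY : (hh.toLp _, Y) ∈ spectralIntegralGraph (ξ + η) (f + g))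
    (hYU : Y ∈ closedSpan (ξ + η) U) :
    ‖functional a D ξ - Y‖ ^ 2 = 1 / (2 * Real.pi) *
      ∫ lam, (f lam * g lam / (f lam + g lam) * ‖transferFn a D lam‖ ^ 2 +
        1 / (f lam + g lam) * ‖hat plusTransform c lam‖ ^ 2) := by
  have hw := hξ.density.add hη.density
  set X := functional a D ξ
  set A := transferFn a D
  set h := optimalCharacteristic A f g c
  have hac := hw.absolutelyContinuous hpos
  have horth : inner ℂ Y (X - Y) = 0 := inner_eq_zero_of_mem_closedSpan (fun t hU =>
    inner_sub_eq_zero hξ hη hξη hpos hai (integrable_hat hw hpos hc) (ht t hU) hh hY) hYU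
  have hX : ‖X‖ ^ 2 = 1 / (2 * Real.pi) * ∫ lam, ‖A lam‖ ^ 2 * f lam := by
    have h1 := norm_sq_functional hξ hai
    rw [one_div_two_pi_ofReal] at h1
    refine ofReal_inj.1 (h1.trans ?_)
    rw [ofReal_mul, ← integral_complex_ofReal]
    congr 2
    ext lam
    rw [← mul_assoc, mul_conj, normSq_eq_norm_sq, ofReal_mul]
  have hYn : ‖Y‖ ^ 2 = 1 / (2 * Real.pi) * ∫ lam, (f lam + g lam) * ‖h lam‖ ^ 2 := by
    rw [spectralIntegralGraph_eq hw] at hY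
    have h1 := inner_eq_of_mem_closure_span (inner_add_process hξ hη hξη) hY hY
    rw [inner_self_eq_ofReal, inner_weighted hw] at h1
    refine ofReal_inj.1 (h1.trans ?_)
    rw [ofReal_mul, ← integral_complex_ofReal]
    congr 1
    refine integral_congr_ae ?_
    filter_upwards [hac.ae_le hh.coeFn_toLp] with lam e1
    rw [e1, mul_conj, normSq_eq_norm_sq, ofReal_mul, Pi.add_apply]
  have hdiff : ‖X - Y‖ ^ 2 = ‖X‖ ^ 2 - ‖Y‖ ^ 2 := by
    have h2 := norm_add_sq_eq_norm_sq_add_norm_sq_of_inner_eq_zero (𝕜 := ℂ) Y (X - Y) horth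
    rw [add_sub_cancel] at h2
    linarith [h2, sq ‖X - Y‖, sq ‖X‖, sq ‖Y‖]
  set C := (memLp_hat_div hw hpos hc).toLp _
  -- The class `C = ĉ / w` is orthogonal in `L₂(w)` to `e^{itλ}` for `t ∈ U`, again by `ht`, hence
  -- to `h` in their closed span.
  have hcross : inner ℂ (hh.toLp h) C = 0 := by
    have h1 : harmonicSpan (f + g) U ≤ LinearMap.ker (innerSL ℂ C).toLinearMap := by
      rw [harmonicSpan_eq hw]
      refine Submodule.topologicalClosure_minimal _ (Submodule.span_le.2 ?_)
        (innerSL ℂ C).isClosed_ker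
      rintro _ ⟨t, hU, rfl⟩
      change inner ℂ C (harmonic hw t) = 0
      rw [← inner_conj_symm, inner_harmonic_left]
      have h3 : ∫ lam : ℝ, ((f + g) lam * C lam) * exp (-(I * t * lam)) =
          ∫ lam : ℝ, hat plusTransform c lam * exp (-(I * t * lam)) := by
        refine integral_congr_ae ?_
        filter_upwards [hac.ae_le (memLp_hat_div hw hpos hc).coeFn_toLp, hpos] with lam e1 e2
        rw [e1, Pi.add_apply, mul_div_cancel₀]
        exact_mod_cast e2.ne'
      rw [h3, ht t hU, map_zero]
    have h2 : inner ℂ C (hh.toLp h) = 0 := h1 hhU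
    rw [← inner_conj_symm, h2, map_zero]
  have hint : Integrable fun lam => hat plusTransform c lam * (starRingEnd ℂ) (h lam) := by
    have h1 : Integrable (fun lam => inner ℂ ((hh.toLp h : Lp ℂ 2 (weighted (f + g))) lam) (C lam))
      (weighted (f + g)) := L2.integrable_inner (𝕜 := ℂ) (hh.toLp h) C
    rw [integrable_weighted_iff hw] at h1
    refine h1.congr ?_
    filter_upwards [hac.ae_le (memLp_hat_div hw hpos hc).coeFn_toLp, hpos,
      hac.ae_le hh.coeFn_toLp] with lam e1 e2 e3
    have e4 : ((f lam + g lam : ℝ) : ℂ) ≠ 0 := by exact_mod_cast e2.ne'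
    rw [e1, e3, RCLike.inner_apply, Pi.add_apply, real_smul]
    field_simp
  have hcross' : ∫ lam, hat plusTransform c lam * (starRingEnd ℂ) (h lam) = 0 := by
    rw [← hcross, inner_weighted hw]
    refine integral_congr_ae ?_
    filter_upwards [hac.ae_le (memLp_hat_div hw hpos hc).coeFn_toLp, hpos,
      hac.ae_le hh.coeFn_toLp] with lam e1 e2 e3
    have e4 : ((f lam + g lam : ℝ) : ℂ) ≠ 0 := by exact_mod_cast e2.ne'
    rw [e1, e3, Pi.add_apply]
    field_simp
  have hre : ∫ lam, (hat plusTransform c lam * (starRingEnd ℂ) (h lam)).re = 0 := by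
    have := integral_re hint
    simp only [RCLike.re_eq_complex_re] at this
    rw [this, hcross', zero_re]
  have i1 := integrable_mul_norm_sq hξ.density (continuous_transferFn hai)
    (norm_transferFn_le a D)
  have i2 : Integrable fun lam => (f lam + g lam) * ‖h lam‖ ^ 2 :=
    (memLp_weighted_iff hw hh.1).1 hh
  have i3 : Integrable fun lam => 2 * (hat plusTransform c lam * (starRingEnd ℂ) (h lam)).re :=
    hint.re.const_mul 2
  have i4 : Integrable fun lam => ‖A lam‖ ^ 2 * f lam - (f lam + g lam) * ‖h lam‖ ^ 2 :=
    i1.sub i2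
  rw [hdiff, hX, hYn, ← mul_sub, ← integral_sub i1 i2]
  congr 1
  -- The vanishing integral of `2 Re (ĉ conj h)` is inserted so that the pointwise identity
  -- `norm_sq_sub_eq` applies.
  rw [← sub_zero (∫ lam, (‖A lam‖ ^ 2 * f lam - (f lam + g lam) * ‖h lam‖ ^ 2)),
    ← mul_zero 2, ← hre, ← integral_const_mul, ← integral_sub i4 i3]
  exact integral_congr_ae (hpos.mono fun lam hl => norm_sq_sub_eq hl rfl)

end Main

theorem kernelForm_self_eq {σ : ℝ → ℝ} (h0 : ∀ lam, 0 ≤ σ lam) (U : L2Transform)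
    (x : Lp ℂ 2 (volume : Measure ℝ)) :
    kernelForm σ U U x x =
      ((1 / (2 * Real.pi) * ∫ lam, σ lam * ‖hat U x lam‖ ^ 2 : ℝ) : ℂ) := by
  rw [kernelForm_eq h0, one_div_two_pi_ofReal, ofReal_mul, ← integral_complex_ofReal]
  congr 2
  ext lam
  rw [mul_conj, normSq_eq_norm_sq, ofReal_mul]

end MissingFilter

end

/-! ### The main theorem -/

open MissingFilter
theorem mainTheorem2
    {Ω : Type*} [MeasurableSpace Ω] (P : Measure Ω)
    [IsProbabilityMeasure P]
    (s : ℕ) (Nl Kl : ℕ → ℝ) (hN0 : Nl 0 = 0) (hK0 : Kl 0 = 0)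
    (hNl : ∀ l ∈ Finset.Icc 1 s, 0 ≤ Nl l) (hKl : ∀ l ∈ Finset.Icc 1 s, 0 ≤ Kl l)
    (N : ℝ) (hN : 0 ≤ N)
    (f g : ℝ → ℝ) (ξ η : ℝ → Lp ℂ 2 P)
    (hξ : IsStationary ξ f) (hη : IsStationary η g)
    (hξη : Uncorrelated ξ η)
    (hmin : MinimalityCondition f g)
    (a : ℝ → ℂ)
    (ha : MemLp a 2
      (volume.restrict (truncSet s Nl Kl N)))
    (hB : IsInvertible
      (opB (unobsSet s Nl Kl) f g)) :
    let T := unobsSet s Nl Kl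
    let U := obsSet s Nl Kl
    let D := truncSet s Nl Kl N
    let X := functional a D ξ
    let A := transferFn a D
    let aN : L2On T := restrictTo
      (measurableSet_truncSet s Nl Kl N)
      (truncSet_subset_unobsSet s Nl Kl N) ha
    ∃ (hR : aN ∈ (opR T f g).domain) (hQ : aN ∈ (opQ T f g).domain),
      let Ra := opR T f g ⟨aN, hR⟩
      let Qa := opQ T f g ⟨aN, hQ⟩
      let c := invApply (opB T f g) hB Ra
      let h := optimalCharacteristic A f g c
      ∃ Y : Lp ℂ 2 P,
        IsOptimalEstimate (ξ + η) U X Y ∧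
        (∀ Y', IsOptimalEstimate (ξ + η) U X Y' → Y' = Y) ∧
        (∀ h' : ℝ → ℂ, IsSpectralCharacteristic (ξ + η) (f + g) U h' Y ↔
          h' =ᵐ[volume] h) ∧
        mse X Y = spectralError A h f g ∧
        (mse X Y : ℂ) =
          pairing Ra c + pairing Qa aN := by
  intro T U D X A aN
  have hf := hξ.density
  have hg := hη.density
  have hw := hf.add hg
  have hT : MeasurableSet T := measurableSet_unobsSet s Nl Kl
  have hpos := hmin.ae_pos hw
  obtain ⟨M, hM⟩ := hmin.exists_ae_le hw hT Set.subset_union_right hB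
  have hai : Integrable a (volume.restrict D) := integrable_of_memLp_truncSet ha
  have hA : Continuous A := continuous_transferFn hai
  have hAb : ∀ lam, ‖A lam‖ ≤ ∫ t in D, ‖a t‖ := norm_transferFn_le a D
  have hR : aN ∈ (opR T f g).domain := mem_domain_opR hf hg hT aN
  have hQ : aN ∈ (opQ T f g).domain := mem_domain_opQ hf hg hM hT aN
  refine ⟨hR, hQ, ?_⟩
  intro Ra Qa c h
  have haA : hat minusTransform aN =ᵐ[volume] A := hat_minus_restrictTo _ _ ha hai
  let cB : (opB T f g).domain := (Equiv.ofBijective _ hB).symm Ra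
  have hBc : opB T f g cB = Ra := Equiv.ofBijective_apply_symm_apply _ hB Ra
  have h0 : ∀ lam, 0 ≤ f lam + g lam := hw.nonneg
  have hσ0 : ∀ lam, 0 ≤ 1 / (f lam + g lam) := fun lam => div_nonneg zero_le_one (h0 lam)
  have hcB : c ∈ formDomain T (fun lam => 1 / (f lam + g lam)) plusTransform :=
    (mem_kernelGraph cB).1
  have hc : Integrable fun lam => 1 / (f lam + g lam) * ‖hat plusTransform c lam‖ ^ 2 :=
    (memLp_weightedHat_iff hσ0 (hw.integrable.aemeasurable.const_div 1) _ _).1 hcB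
  have hh : MemLp h 2 (weighted (f + g)) := memLp_optimalCharacteristic hf hg hpos hA hAb hc
  have hhU : hh.toLp h ∈ harmonicSpan (f + g) U :=
    optimalCharacteristic_mem_harmonicSpan hf hg hpos hM
      (fun t ht => (mem_obsSet_iff s Nl Kl t).2 ht) haA hR cB hBc hh
  have hcov := inner_add_process hξ hη hξη
  have hκ : (0 : ℝ) < 1 / (2 * Real.pi) := by positivity
  have hκ1 : 1 / (2 * Real.pi) ≤ 1 := by
    rw [div_le_one (by positivity)]
    linarith [Real.pi_gt_three]
  obtain ⟨Y, hYU, hYG⟩ := exists_mem_closure_span_of_isometry hκ1 hcov U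
    (x := hh.toLp h) (by rw [← harmonicSpan_eq hw]; exact hhU)
  have hG : (hh.toLp h, Y) ∈ spectralIntegralGraph (ξ + η) (f + g) := by
    rw [spectralIntegralGraph_eq hw]
    exact Submodule.topologicalClosure_mono (Submodule.span_mono (Set.image_subset_range _ _)) hYG
  have hzero : ∀ t ∈ U, ∫ lam : ℝ, hat plusTransform c lam * exp (-(I * t * lam)) = 0 :=
    fun t ht => integral_hat_mul_exp_eq_zero c (integrable_hat hw hpos hc)
      (isOpen_obsSet s Nl Kl) (fun u hu => (mem_obsSet_iff s Nl Kl u).1 hu) ht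
  have horth : ∀ t ∈ U, inner ℂ ((ξ + η) t) (X - Y) = 0 := fun t ht =>
    inner_sub_eq_zero hξ hη hξη hpos hai (integrable_hat hw hpos hc) (hzero t ht) hh hG
  have hmse := norm_sub_sq_eq hξ hη hξη hpos hai hc hzero hh hhU hG hYU
  have herr := spectralError_eq hf hg hpos hA hAb hc
  refine ⟨Y, isOptimalEstimate_of_orthogonal hYU horth,
    fun Y' hY' => hY'.eq_of_orthogonal hYU horth,
    isSpectralCharacteristic_iff hw hpos hκ hcov ⟨hh, hhU, hG⟩, ?_, ?_⟩
  · rw [mse_eq_norm_sq, hmse, herr]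
  · have hQ0 : ∀ lam, 0 ≤ f lam * g lam / (f lam + g lam) := fun lam =>
      div_nonneg (mul_nonneg (hf.nonneg lam) (hg.nonneg lam)) (h0 lam)
    -- `R a_N = B c`, and `c` lies in the form domain of `B`, so the pairing is the form of `B` at
    -- `(c, c)`.
    have e1 : inner ℂ c Ra =
        kernelForm (fun lam => 1 / (f lam + g lam)) plusTransform plusTransform c c := by
      rw [← hBc]
      exact inner_kernelOp cB hcB
    have e2 : inner ℂ aN Qa = kernelForm (fun lam => f lam * g lam / (f lam + g lam))
        minusTransform minusTransform aN aN :=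
      inner_kernelOp (⟨aN, hQ⟩ : (opQ T f g).domain)
        (mem_kernelGraph (⟨aN, hQ⟩ : (opQ T f g).domain)).1
    rw [pairing_eq_inner hT, pairing_eq_inner hT, e1, e2, kernelForm_self_eq hσ0,
      kernelForm_self_eq hQ0, ← ofReal_add, mse_eq_norm_sq, hmse, ← mul_add]
    congr 2
    rw [add_comm (∫ lam, 1 / (f lam + g lam) * ‖hat plusTransform c lam‖ ^ 2),
      integral_add (integrable_mul_div_mul_norm_sq hf hg hA hAb) hc]
    congr 1
    refine integral_congr_ae ?_
    filter_upwards [haA] with lam hl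
    rw [hl]
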